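/- Let $X_1,X_2,\ldots$ be independent $N(\xi,\sigma^2)$ random variables with $\xi\neq0$ and $\sigma>0$ (both unknown). For $n\ge2$ put $\bar X_n=\frac1n\sum_{i=1}^nX_i$ and $\widehat\sigma_n^2=\frac1{n-1}\sum_{i=1}^n(X_i-\bar X_n)^2$, and for $d\in\mathbb R$ consider the estimator $\theta_n^*(d)=(\bar X_n)^2-d\,\widehat\sigma_n^2/n$ of $\xi^2$. Let $a(\varepsilon)$ be any function with $a(\varepsilon)\to0$ and $a(\varepsilon)/\varepsilon^2\to\infty$ as $\varepsilon\to0^+$ (for example $a(\varepsilon)=\varepsilon$), and let $Q^*_\varepsilon(d)$ be the number of integers $n\ge 2$ with $n\ge a(\varepsilon)/\varepsilon^2$ and $|\theta_n^*(d)-\xi^2|\ge\varepsilon$. Then, for every $d$ and every $\varepsilon>0$, $Q^*_\varepsilon(d)$ is almost surely finite and has finite expectation, and for every $d\in\mathbb R$ $$\lim_{\varepsilon\to0^+}\mathrm E\{Q^*_\varepsilon(d)-Q^*_\varepsilon(0)\}=\bigl(\tfrac14d^2+\tfrac12d\bigr)\frac{\sigma^2}{\xi^2}.$$ Consequently the estimator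 $(\bar X_n)^2+\widehat\sigma_n^2/n$, i.e. $d=-1$, is the unique best one in this class: the limit above is strictly smaller at $d=-1$ than at any other $d$, and for every $d\neq-1$ $$\lim_{\varepsilon\to0^+}\mathrm E\{Q^*_\varepsilon(d)-Q^*_\varepsilon(-1)\}=\tfrac14(d+1)^2\,\frac{\sigma^2}{\xi^2}>0,$$ so that $\mathrm E\,Q^*_\varepsilon(-1)<\mathrm E\,Q^*_\varepsilon(d)$ for all sufficiently small $\varepsilon>0$. -/

import Mathlib

open MeasureTheory ProbabilityTheory Filter Topology
open scoped NNReal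

/-- The mean of the first `n` observations `x 0, …, x (n - 1)`. -/
noncomputable def sampleMean (x : ℕ → ℝ) (n : ℕ) : ℝ :=
  (∑ i ∈ Finset.range n, x i) / (n : ℝ)

/-- The unbiased variance estimate from the first `n ≥ 2` observations. -/
noncomputable def sampleVar (x : ℕ → ℝ) (n : ℕ) : ℝ :=
  (∑ i ∈ Finset.range n, (x i - sampleMean x n) ^ 2) / ((n : ℝ) - 1)

/-- The estimator `(sample mean)² - d * (sample variance) / n` of the squared mean. -/
noncomputable def sqMeanEstimator (d : ℝ) (x : ℕ → ℝ) (n : ℕ) : ℝ :=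
  sampleMean x n ^ 2 - d * sampleVar x n / (n : ℝ)

/-- The sample sizes `n ≥ N` at which the estimator with constant `d` misses the target `θ`
by at least `ε`. Only `n ≥ 2` is considered, since the variance estimate needs two observations. -/
def missSet (d θ ε N : ℝ) (x : ℕ → ℝ) : Set ℕ :=
  {n : ℕ | 2 ≤ n ∧ N ≤ (n : ℝ) ∧ ε ≤ |sqMeanEstimator d x n - θ|}

/-- The number of `ε`-misses (meaningful when `missSet` is finite). -/
noncomputable def missCount (d θ ε N : ℝ) (x : ℕ → ℝ) : ℝ :=
  ((missSet d θ ε N x).ncard : ℝ)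

/-! Put `τ = σ/|ξ|` and `X_i = ξ + τξ Y_i` with `Y_i` standard normal. Let `Z` be `√n` times the
mean of the `Y_i`, and `W` their sample variance. Then the estimation error is `(2τξ²/√n)(Z + b(Z² -
dW))` with `b = τ/(2√n)`, so a miss at `n` is the event `|Z + b(Z² - dW)| ≥ u` with `u = κ√n`, `κ =
ε/(2τξ²)`. The expected count is the sum of the probabilities of these events.

`Z` is independent of `W`, so one may condition on `W` and study `P(|Z + b(Z² - s)| ≥ u)` at `s =
dW`. By symmetry this is a sum of two upper tails, for `b` and `-b`, each a normal tail beyond a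
root of a quadratic up to `O(b⁴)`. The first-order effects of `s` cancel between the two signs, and
the second-order effect is `b² φ(u) u (s² + 4s - 2u²s)` with error `O(b³(1+|s|)³)` uniform in `u`
(`exists_abs_quadTail_sub_le`). Since `E W = 1` and `E W² = 1 + O(1/n)`, averaging gives `b² φ(u) u
(d² + 4d - 2du²)`.

At `u = κ√n`, `b² = τ²/(4n)` this is `τ²/2` times the derivative in `x = n` of `M(κ√x)`, where `M =
gainPrim d`. The sum over `n ≥ N` therefore telescopes to `(τ²/2)(M(∞) - M(κ√N))`, up to the tail of
a convergent series `∑ n^(-3/2)`, uniformly in `κ` (`exists_abs_tsum_devProb_sub_le`). With `N ≈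
a(ε)/ε²`, divergence of `N` removes the error, and `a(ε) → 0` gives `κ√N → 0` and `M(κ√N) → 0`. What
remains is `(τ²/2) M(∞) = (d²/4 + d/2) τ²`, a parabola in `d` with its minimum at `-1`. -/

/-! ### The normal density and its primitive. -/

/-- The standard normal density. -/
noncomputable def gaussDens (x : ℝ) : ℝ := (√(2 * Real.pi))⁻¹ * Real.exp (-x ^ 2 / 2)

/-- The primitive of the standard normal density that vanishes at `0`. -/
noncomputable def gaussPrim (x : ℝ) : ℝ := ∫ t in (0 : ℝ)..x, gaussDens t

lemma gaussianPDFReal_eq_gaussDens (x : ℝ) : gaussianPDFReal 0 1 x = gaussDens x := by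
  simp [gaussianPDFReal, gaussDens]

lemma continuous_gaussDens : Continuous gaussDens := by
  unfold gaussDens; fun_prop

lemma gaussDens_pos (x : ℝ) : 0 < gaussDens x := by
  unfold gaussDens; positivity

lemma hasDerivAt_gaussDens (x : ℝ) : HasDerivAt gaussDens (-x * gaussDens x) x := by
  unfold gaussDens
  have h : HasDerivAt (fun y : ℝ => -y ^ 2 / 2) (-x) x := by
    have := ((hasDerivAt_id x).pow 2).neg.div_const 2
    convert! this using 1
    simp
    ring
  convert! (h.exp).const_mul ((√(2 * Real.pi))⁻¹) using 1
  ring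

lemma integrable_gaussDens : Integrable gaussDens := by
  have := integrable_gaussianPDFReal 0 1
  exact this.congr (ae_of_all _ gaussianPDFReal_eq_gaussDens)

/-- Source of all uniformity in `u`. Degree 6 is the highest power of `1 + |z|` met in the estimate
of the derivative of `rootDensDeriv`. -/
lemma gaussDens_mul_le (x : ℝ) : gaussDens x * (1 + |x|) ^ 6 ≤ 768 := by
  have h1 : (√(2 * Real.pi))⁻¹ ≤ 1 := by
    apply inv_le_one_of_one_le₀
    rw [Real.one_le_sqrt]
    linarith [Real.pi_gt_three]
  have h2 : (1 + |x|) ^ 6 ≤ 8 * (1 + x ^ 2) ^ 3 := by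
    have h : (1 + |x|) ^ 2 ≤ 2 * (1 + x ^ 2) := by
      nlinarith [sq_nonneg (1 - |x|), sq_abs x]
    calc (1 + |x|) ^ 6 = ((1 + |x|) ^ 2) ^ 3 := by ring
      _ ≤ (2 * (1 + x ^ 2)) ^ 3 := by gcongr
      _ = _ := by ring
  have h3 : ((1 + x ^ 2) / 2) ^ 3 / 6 ≤ Real.exp ((1 + x ^ 2) / 2) := by
    have := Real.pow_div_factorial_le_exp ((1 + x ^ 2) / 2) (by positivity) 3
    simpa [Nat.factorial] using this
  have h4 : Real.exp (1 / 2) ≤ 2 := by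
    have := Real.exp_one_lt_d9
    have e : Real.exp (1 / 2) ^ 2 = Real.exp 1 := by rw [← Real.exp_nat_mul]; norm_num
    nlinarith [Real.exp_pos (1 / 2)]
  have h5 : Real.exp (-x ^ 2 / 2) * Real.exp ((1 + x ^ 2) / 2) = Real.exp (1 / 2) := by
    rw [← Real.exp_add]; congr 1; ring
  have h6 : gaussDens x ≤ Real.exp (-x ^ 2 / 2) := by
    unfold gaussDens
    exact mul_le_of_le_one_left (Real.exp_pos _).le h1
  calc gaussDens x * (1 + |x|) ^ 6
      ≤ Real.exp (-x ^ 2 / 2) * (8 * (1 + x ^ 2) ^ 3) := by gcongr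
    _ = 384 * (Real.exp (-x ^ 2 / 2) * (((1 + x ^ 2) / 2) ^ 3 / 6)) := by ring
    _ ≤ 384 * (Real.exp (-x ^ 2 / 2) * Real.exp ((1 + x ^ 2) / 2)) := by gcongr
    _ ≤ 768 := by rw [h5]; linarith

lemma gaussDens_mul_pow_le (x : ℝ) {k : ℕ} (hk : k ≤ 6) : gaussDens x * |x| ^ k ≤ 768 := by
  refine le_trans ?_ (gaussDens_mul_le x)
  have := gaussDens_pos x
  have h1 : |x| ^ k ≤ (1 + |x|) ^ k := by gcongr; linarith
  have h2 : (1 + |x|) ^ k ≤ (1 + |x|) ^ 6 := pow_le_pow_right₀ (by linarith [abs_nonneg x]) hk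
  gcongr
  exact h1.trans h2

lemma hasDerivAt_gaussPrim (x : ℝ) : HasDerivAt gaussPrim (gaussDens x) x :=
  continuous_gaussDens.integral_hasStrictDerivAt 0 x |>.hasDerivAt

lemma gaussPrim_zero : gaussPrim 0 = 0 := by simp [gaussPrim]

lemma integral_Ioi_gaussDens : ∫ t in Set.Ioi (0 : ℝ), gaussDens t = 1 / 2 := by
  unfold gaussDens
  rw [integral_const_mul]
  have : ∫ t in Set.Ioi (0 : ℝ), Real.exp (-t ^ 2 / 2) = √(Real.pi / (1 / 2)) / 2 := by
    rw [← integral_gaussian_Ioi]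
    congr 1; ext t; congr 1; ring
  rw [this, show Real.pi / (1 / 2) = 2 * Real.pi by ring]
  have : √(2 * Real.pi) ≠ 0 := by positivity
  field_simp

lemma tendsto_gaussPrim : Tendsto gaussPrim atTop (𝓝 (1 / 2)) := by
  rw [← integral_Ioi_gaussDens]
  exact intervalIntegral_tendsto_integral_Ioi 0 integrable_gaussDens.integrableOn tendsto_id

lemma gaussianReal_real_Ici (x : ℝ) :
    (gaussianReal 0 1).real (Set.Ici x) = 1 / 2 - gaussPrim x := by
  have h1 : (gaussianReal 0 1).real (Set.Ici x) = ∫ t in Set.Ioi x, gaussDens t := by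
    rw [measureReal_def, gaussianReal_apply_eq_integral 0 one_ne_zero, ENNReal.toReal_ofReal,
      integral_Ici_eq_integral_Ioi]
    · simp_rw [gaussianPDFReal_eq_gaussDens]
    · exact integral_nonneg fun t => gaussianPDFReal_nonneg _ _ _
  have h2 := intervalIntegral.integral_interval_add_Ioi (a := 0) (b := x) (f := gaussDens)
    (μ := volume) integrable_gaussDens.integrableOn integrable_gaussDens.integrableOn
  rw [integral_Ioi_gaussDens] at h2
  rw [h1, ← h2, gaussPrim]; ring

/-! ### The root of the perturbed equation and its derivatives. -/

/-- The discriminant root `√(1 + 4b(u + bs))` of the equation `z + b(z² - s) = u`. -/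
noncomputable def quadDisc (b u s : ℝ) : ℝ := √(1 + 4 * b * (u + b * s))

/-- The solution `z` of `z + b(z² - s) = u` that stays bounded as `b → 0`. -/
noncomputable def quadRoot (b u s : ℝ) : ℝ := 2 * (u + b * s) / (1 + quadDisc b u s)

section Root

variable {b u s : ℝ}

/-- The rationalised form of the root involves no division by `b`, so the identities include `b =
0`, where the root is `u`. -/
lemma quadDisc_eq (h : 0 ≤ 1 + 4 * b * (u + b * s)) :
    quadDisc b u s = 1 + 2 * b * quadRoot b u s := by
  have h1 : 0 ≤ quadDisc b u s := Real.sqrt_nonneg _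
  have h2 : quadDisc b u s ^ 2 = 1 + 4 * b * (u + b * s) := Real.sq_sqrt h
  have h3 : 1 + quadDisc b u s ≠ 0 := by positivity
  unfold quadRoot
  field_simp
  linarith

lemma quadRoot_spec (h : 0 ≤ 1 + 4 * b * (u + b * s)) :
    quadRoot b u s + b * (quadRoot b u s ^ 2 - s) = u := by
  have h1 : 0 ≤ quadDisc b u s := Real.sqrt_nonneg _
  have h2 := quadDisc_eq h
  have h3 : quadRoot b u s * (1 + quadDisc b u s) = 2 * (u + b * s) := by
    unfold quadRoot; field_simp
  rw [h2] at h3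
  linarith

lemma quadDisc_pos (h : 0 < 1 + 4 * b * (u + b * s)) : 0 < quadDisc b u s := Real.sqrt_pos.2 h

lemma hasDerivAt_quadDisc_left (h : 0 < 1 + 4 * b * (u + b * s)) :
    HasDerivAt (fun b => quadDisc b u s) ((2 * u + 4 * b * s) / quadDisc b u s) b := by
  have h1 : HasDerivAt (fun b : ℝ => 1 + 4 * b * (u + b * s)) (4 * u + 8 * b * s) b := by
    have := ((((hasDerivAt_id b).const_mul 4).mul
      (((hasDerivAt_id b).mul_const s).const_add u)).const_add 1)
    convert! this using 1
    simp; ring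
  have h2 := h1.sqrt h.ne'
  convert! h2 using 1
  have := quadDisc_pos h
  unfold quadDisc at this ⊢
  field_simp; ring

lemma hasDerivAt_quadDisc_right (h : 0 < 1 + 4 * b * (u + b * s)) :
    HasDerivAt (fun s => quadDisc b u s) (2 * b ^ 2 / quadDisc b u s) s := by
  have h1 : HasDerivAt (fun s : ℝ => 1 + 4 * b * (u + b * s)) (4 * b ^ 2) s := by
    have := (((((hasDerivAt_id s).const_mul b).const_add u).const_mul (4 * b)).const_add 1)
    convert! this using 1
    simp; ring
  have h2 := h1.sqrt h.ne'
  convert! h2 using 1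
  have := quadDisc_pos h
  unfold quadDisc at this ⊢
  field_simp; ring

/-- Implicit differentiation of `z + b(z² - s) = u` gives `(1 + 2bz) z' = s - z²`, and `1 + 2bz` is
`quadDisc`. -/
lemma hasDerivAt_quadRoot_left (h : 0 < 1 + 4 * b * (u + b * s)) :
    HasDerivAt (fun b => quadRoot b u s)
      ((s - quadRoot b u s ^ 2) / quadDisc b u s) b := by
  have hr := quadDisc_pos h
  have h1 : HasDerivAt (fun b : ℝ => 2 * (u + b * s)) (2 * s) b := by
    simpa using ((((hasDerivAt_id b).mul_const s).const_add u).const_mul 2)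
  have h2 := h1.div ((hasDerivAt_quadDisc_left h).const_add 1) (by positivity)
  convert! h2 using 1
  have e1 := quadDisc_eq h.le
  have e2 := quadRoot_spec h.le
  set z := quadRoot b u s
  generalize quadDisc b u s = r at *
  clear_value z
  have h1r : 1 + r ≠ 0 := by positivity
  rw [← e2]
  field_simp
  rw [e1]
  ring

lemma hasDerivAt_quadRoot_right (h : 0 < 1 + 4 * b * (u + b * s)) :
    HasDerivAt (fun s => quadRoot b u s) (b / quadDisc b u s) s := by
  have hr := quadDisc_pos h
  have h1 : HasDerivAt (fun s : ℝ => 2 * (u + b * s)) (2 * b) s := by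
    simpa using ((((hasDerivAt_id s).const_mul b).const_add u).const_mul 2)
  have h2 := h1.div ((hasDerivAt_quadDisc_right h).const_add 1) (by positivity)
  convert! h2 using 1
  have e1 := quadDisc_eq h.le
  have e2 := quadRoot_spec h.le
  set z := quadRoot b u s
  generalize quadDisc b u s = r at *
  clear_value z
  have h1r : 1 + r ≠ 0 := by positivity
  rw [← e2]
  field_simp
  rw [e1]
  ring

/-- Where `|2bz| < 1`, the inequality `u ≤ z + b(z² - s)` means that `z` is at least the root. -/
lemma le_quad_iff (h : 0 < 1 + 4 * b * (u + b * s)) {z : ℝ} (hz : 2 * |b| * |z| < 1) :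
    u ≤ z + b * (z ^ 2 - s) ↔ quadRoot b u s ≤ z := by
  have e1 := quadDisc_eq h.le
  have e2 := quadRoot_spec h.le
  have hr := quadDisc_pos h
  set w := quadRoot b u s
  have h1 : -(1 / 2) < b * z := by
    have := neg_abs_le (b * z)
    rw [abs_mul] at this
    linarith
  have h2 : 0 < 1 + b * (z + w) := by nlinarith
  have h3 : z + b * (z ^ 2 - s) - u = (z - w) * (1 + b * (z + w)) := by rw [← e2]; ring
  rw [← sub_nonneg, h3, ← sub_nonneg (a := z), mul_nonneg_iff_of_pos_right h2]

end Root

/-! ### Expansion in `b`, with remainders uniform in `u`. -/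

/-- The density factor `φ(z) / r` that arises by differentiating a normal tail probability at the
root `z`, with `r` the discriminant root. -/
noncomputable def rootDens (u s b : ℝ) : ℝ := gaussDens (quadRoot b u s) * (quadDisc b u s)⁻¹

/-- The derivative of `rootDens u s` with respect to `b`. -/
noncomputable def rootDensDeriv (u s b : ℝ) : ℝ :=
  gaussDens (quadRoot b u s) *
    (-quadRoot b u s * (s - quadRoot b u s ^ 2) * (quadDisc b u s)⁻¹ ^ 2
      - 2 * quadRoot b u s * (quadDisc b u s)⁻¹ ^ 2
      - 2 * b * (s - quadRoot b u s ^ 2) * (quadDisc b u s)⁻¹ ^ 3)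

section Taylor

variable {b u s : ℝ}

lemma hasDerivAt_inv_quadDisc (h : 0 < 1 + 4 * b * (u + b * s)) :
    HasDerivAt (fun b => (quadDisc b u s)⁻¹)
      (-2 * quadRoot b u s * (quadDisc b u s)⁻¹ ^ 2
        - 2 * b * (s - quadRoot b u s ^ 2) * (quadDisc b u s)⁻¹ ^ 3) b := by
  have hr := quadDisc_pos h
  convert! (hasDerivAt_quadDisc_left h).inv hr.ne' using 1
  have e1 := quadDisc_eq h.le
  have e2 := quadRoot_spec h.le
  set z := quadRoot b u s
  rw [e1] at hr ⊢
  rw [← e2]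
  field_simp
  ring

lemma hasDerivAt_rootDens (h : 0 < 1 + 4 * b * (u + b * s)) :
    HasDerivAt (rootDens u s) (rootDensDeriv u s b) b := by
  have h1 := (hasDerivAt_gaussDens (quadRoot b u s)).comp b (hasDerivAt_quadRoot_left h)
  convert! h1.mul (hasDerivAt_inv_quadDisc h) using 1
  unfold rootDensDeriv
  simp only [Function.comp, div_eq_mul_inv]
  ring

/-- Every term is `φ(z)` times a polynomial in `z`, `s`, `b` and `1/r`, where `r` is the
discriminant root. Since `1/r ≤ 2`, the density absorbs all powers of `z`, and only a quadratic
growth in `s` is left. -/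
lemma exists_hasDerivAt_rootDensDeriv (h : 1 / 4 ≤ 1 + 4 * b * (u + b * s)) (hb : |b| ≤ 1) :
    ∃ K, HasDerivAt (rootDensDeriv u s) K b ∧ |K| ≤ 1040 * 768 * (1 + |s|) ^ 2 := by
  have h0 : 0 < 1 + 4 * b * (u + b * s) := by linarith
  have hz := hasDerivAt_quadRoot_left h0
  have hp := hasDerivAt_inv_quadDisc h0
  have hφ := (hasDerivAt_gaussDens (quadRoot b u s)).comp b hz
  have hq := (hz.pow 2).const_sub s
  have hA := (((hz.neg.mul hq).mul (hp.pow 2)).sub ((hz.const_mul 2).mul (hp.pow 2))).sub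
    ((((hasDerivAt_id b).const_mul 2).mul hq).mul (hp.pow 3))
  have key := hφ.mul hA
  refine ⟨_, key, ?_⟩
  have hr : 1 / 2 ≤ quadDisc b u s := by
    unfold quadDisc
    apply Real.le_sqrt_of_sq_le
    linarith
  simp only [Function.comp, Pi.mul_apply, Pi.sub_apply, Pi.neg_apply, Pi.pow_apply, id,
    div_eq_mul_inv]
  set z := quadRoot b u s
  set p := (quadDisc b u s)⁻¹ with hpdef
  have hp0 : 0 ≤ p := by positivity
  have hp2 : p ≤ 2 := by
    rw [hpdef]; apply inv_le_of_inv_le₀ <;> linarith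
  set g := gaussDens z
  have hg : 0 < g := gaussDens_pos z
  have hB : g * (1 + |z|) ^ 6 ≤ 768 := gaussDens_mul_le z
  clear_value z p g
  set a := 1 + |z|
  set t := 1 + |s|
  have ha : 1 ≤ a := by simp [a]
  have ht : 1 ≤ t := by simp [t]
  have hza : |z| ≤ a := by simp [a]
  have hpa : |p| ≤ 2 := by rwa [abs_of_nonneg hp0]
  have mono : ∀ i j : ℕ, i ≤ 2 → j ≤ 6 → t ^ i * a ^ j ≤ t ^ 2 * a ^ 6 := fun i j hi hj =>
    mul_le_mul (pow_le_pow_right₀ ht hi) (pow_le_pow_right₀ ha hj) (by positivity) (by positivity)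
  have m12 := mono 1 2 (by norm_num) (by norm_num)
  have m13 := mono 1 3 (by norm_num) (by norm_num)
  have m14 := mono 1 4 (by norm_num) (by norm_num)
  have m24 := mono 2 4 (by norm_num) (by norm_num)
  have m25 := mono 2 5 (by norm_num) (by norm_num)
  have hq : |s - z ^ 2| ≤ t * a ^ 2 := by
    have h1 : |s - z ^ 2| ≤ |s| + |z| ^ 2 := by
      have := abs_sub s (z ^ 2)
      rwa [abs_pow] at this
    have h2 : |z| ^ 2 ≤ a ^ 2 := by gcongr
    have h3 : 1 ≤ a ^ 2 := one_le_pow₀ ha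
    have h4 : |s| * 1 ≤ |s| * a ^ 2 := by gcongr
    have h5 : t * a ^ 2 = a ^ 2 + |s| * a ^ 2 := by simp only [t]; ring
    linarith
  have mulle : ∀ {x y X Y : ℝ}, |x| ≤ X → |y| ≤ Y → |x * y| ≤ X * Y := fun hx hy => by
    rw [abs_mul]; exact mul_le_mul hx hy (abs_nonneg _) ((abs_nonneg _).trans hx)
  have powle : ∀ {x X : ℝ} (k : ℕ), |x| ≤ X → |x ^ k| ≤ X ^ k := fun k hx => by
    rw [abs_pow]; gcongr
  set q := s - z ^ 2
  -- `D` and `E` are the `b`-derivatives of the root `z` and of `p = 1/r`; `g * A` is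
  -- `rootDensDeriv`. Keeping them opaque lets each term be bounded as a product.
  obtain ⟨D, hD⟩ : ∃ D, D = q * p := ⟨_, rfl⟩
  obtain ⟨E, hE⟩ : ∃ E, E = -2 * z * p ^ 2 - 2 * b * q * p ^ 3 := ⟨_, rfl⟩
  obtain ⟨A, hA'⟩ : ∃ A, A = -z * q * p ^ 2 - 2 * z * p ^ 2 - 2 * b * q * p ^ 3 := ⟨_, rfl⟩
  have bD : |D| ≤ 2 * (t * a ^ 2) := by
    rw [hD]; exact (mulle hq hpa).trans_eq (by ring)
  have a12 : a ≤ t * a ^ 2 := by nlinarith [mul_le_mul ht ha zero_le_one (by positivity)]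
  have bzp : |z * p ^ 2| ≤ 4 * a := (mulle hza (powle 2 hpa)).trans_eq (by ring)
  have bqp : |b * q * p ^ 3| ≤ 8 * (t * a ^ 2) :=
    (mulle (mulle hb hq) (powle 3 hpa)).trans_eq (by ring)
  have bE : |E| ≤ 24 * (t * a ^ 2) := by
    rw [hE]
    calc _ = |2 * (z * p ^ 2) + 2 * (b * q * p ^ 3)| := by
          rw [← abs_neg]; congr 1; ring
      _ ≤ |2 * (z * p ^ 2)| + |2 * (b * q * p ^ 3)| := abs_add_le _ _
      _ = 2 * |z * p ^ 2| + 2 * |b * q * p ^ 3| := by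
          rw [abs_mul 2, abs_mul 2]; norm_num
      _ ≤ _ := by linarith
  have bA : |A| ≤ 28 * (t * a ^ 3) := by
    have h1 : |D * (z * p)| ≤ 4 * (t * a ^ 3) :=
      (mulle bD (mulle hza hpa)).trans_eq (by ring)
    have h2 : A = -(D * (z * p)) + E := by rw [hA', hE, hD]; ring
    have h3 : t * a ^ 2 ≤ t * a ^ 3 := by
      gcongr
      norm_num
    rw [h2]
    calc _ ≤ |-(D * (z * p))| + |E| := abs_add_le _ _
      _ ≤ _ := by rw [abs_neg]; linarith
  have b0 : |z * D * A| ≤ 56 * (t ^ 2 * a ^ 6) := (mulle (mulle hza bD) bA).trans_eq (by ring)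
  have b1 : |D * q * p ^ 2| ≤ 8 * (t ^ 2 * a ^ 4) :=
    (mulle (mulle bD hq) (powle 2 hpa)).trans_eq (by ring)
  have b2 : |z ^ 2 * D * p ^ 2| ≤ 8 * (t ^ 1 * a ^ 4) :=
    (mulle (mulle (powle 2 hza) bD) (powle 2 hpa)).trans_eq (by ring)
  have b3 : |z * q * p * E| ≤ 48 * (t ^ 2 * a ^ 5) :=
    (mulle (mulle (mulle hza hq) hpa) bE).trans_eq (by ring)
  have b4 : |D * p ^ 2| ≤ 8 * (t ^ 1 * a ^ 2) := (mulle bD (powle 2 hpa)).trans_eq (by ring)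
  have b5 : |z * p * E| ≤ 48 * (t ^ 1 * a ^ 3) := (mulle (mulle hza hpa) bE).trans_eq (by ring)
  have b6 : |q * p ^ 3| ≤ 8 * (t ^ 1 * a ^ 2) := (mulle hq (powle 3 hpa)).trans_eq (by ring)
  have b7 : |b * z * D * p ^ 3| ≤ 16 * (t ^ 1 * a ^ 3) :=
    (mulle (mulle (mulle hb hza) bD) (powle 3 hpa)).trans_eq (by ring)
  have b8 : |b * q * p ^ 2 * E| ≤ 96 * (t ^ 2 * a ^ 4) :=
    (mulle (mulle (mulle hb hq) (powle 2 hpa)) bE).trans_eq (by ring)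
  -- 1040 is the sum of the bounds `b0`–`b8` weighted by the coefficients.
  have main : |-(z * D * A) - D * q * p ^ 2 + 2 * (z ^ 2 * D * p ^ 2) - 2 * (z * q * p * E)
      - 2 * (D * p ^ 2) - 4 * (z * p * E) - 2 * (q * p ^ 3) + 4 * (b * z * D * p ^ 3)
      - 6 * (b * q * p ^ 2 * E)| ≤ 1040 * (t ^ 2 * a ^ 6) := by
    rw [abs_le] at b0 b1 b2 b3 b4 b5 b6 b7 b8 ⊢
    constructor <;> linarith [b0.1, b0.2, b1.1, b1.2, b2.1, b2.2, b3.1, b3.2, b4.1, b4.2, b5.1,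
      b5.2, b6.1, b6.2, b7.1, b7.2, b8.1, b8.2]
  calc _ = g * |-(z * D * A) - D * q * p ^ 2 + 2 * (z ^ 2 * D * p ^ 2) - 2 * (z * q * p * E)
      - 2 * (D * p ^ 2) - 4 * (z * p * E) - 2 * (q * p ^ 3) + 4 * (b * z * D * p ^ 3)
      - 6 * (b * q * p ^ 2 * E)| := by
        rw [← abs_of_pos hg, ← abs_mul, abs_of_pos hg, hA', hE, hD]
        congr 1
        push_cast
        ring
    _ ≤ g * (1040 * (t ^ 2 * a ^ 6)) := by gcongr
    _ = 1040 * (g * a ^ 6) * t ^ 2 := by ring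
    _ ≤ 1040 * 768 * t ^ 2 := by gcongr

end Taylor

section Taylor

variable {b u s : ℝ}

/-- The bound covers all of `[-b, b]`, so that the mean value inequality can be used across `0`. -/
lemma quarter_le_disc (hb : 0 ≤ b) (hbs : b * (1 + |s|) ≤ 1 / 16) (hu : 0 ≤ u)
    (hbu : b * u ≤ 1 / 16) {β : ℝ} (hβ : |β| ≤ b) : 1 / 4 ≤ 1 + 4 * β * (u + β * s) := by
  have h1 : |β * u| ≤ 1 / 16 := by
    rw [abs_mul, abs_of_nonneg hu]
    exact (mul_le_mul_of_nonneg_right hβ hu).trans hbu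
  have hbs' : b * |s| ≤ 1 / 16 := by linarith
  have hb' : b ≤ 1 / 16 := by nlinarith [abs_nonneg s]
  have h2 : |β * (β * s)| ≤ 1 / 16 := by
    rw [abs_mul, abs_mul]
    calc |β| * (|β| * |s|) ≤ b * (b * |s|) := by gcongr
      _ ≤ 1 * (1 / 16) := by gcongr; linarith
      _ = _ := by ring
  have := abs_le.1 h1
  have := abs_le.1 h2
  nlinarith

/-- In a difference over the symmetric interval the even part in `b` drops out, leaving `2b` times
the derivative at `0`. The constant is `2 * 1040 * 768`. -/
lemma abs_rootDens_sub_le (hb : 0 ≤ b) (hbs : b * (1 + |s|) ≤ 1 / 16) (hu : 0 ≤ u)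
    (hbu : b * u ≤ 1 / 16) :
    |rootDens u s b - rootDens u s (-b) - 2 * b * (gaussDens u * u * (u ^ 2 - s - 2))|
      ≤ 1597440 * b ^ 2 * (1 + |s|) ^ 2 := by
  have hb' : b ≤ 1 := by nlinarith [abs_nonneg s]
  have dom : ∀ β ∈ Set.Icc (-b) b, 1 / 4 ≤ 1 + 4 * β * (u + β * s) := fun β hβ =>
    quarter_le_disc hb hbs hu hbu (abs_le.2 hβ)
  have hex : ∀ β ∈ Set.Icc (-b) b, ∃ K, HasDerivAt (rootDensDeriv u s) K β ∧
      |K| ≤ 1040 * 768 * (1 + |s|) ^ 2 := fun β hβ =>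
    exists_hasDerivAt_rootDensDeriv (dom β hβ) ((abs_le.2 hβ).trans hb')
  have h0 : rootDensDeriv u s 0 = gaussDens u * u * (u ^ 2 - s - 2) := by
    simp [rootDensDeriv, quadRoot, quadDisc, show (1 + 1 : ℝ) = 2 by norm_num]
    ring
  have hmem0 : (0 : ℝ) ∈ Set.Icc (-b) b := ⟨by linarith, hb⟩
  have hstep : ∀ β ∈ Set.Icc (-b) b, ‖rootDensDeriv u s β - rootDensDeriv u s 0‖
      ≤ 1040 * 768 * (1 + |s|) ^ 2 * b := by
    intro β hβ
    choose! K hK hKb using hex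
    refine ((convex_Icc (-b) b).norm_image_sub_le_of_norm_hasDerivWithin_le
      (fun x hx => (hK x hx).hasDerivWithinAt) (fun x hx => hKb x hx) hmem0 hβ).trans ?_
    gcongr
    simpa using abs_le.2 hβ
  -- Subtracting the tangent at `0` leaves a function whose derivative is `O(b)` by `hstep`, over an
  -- interval of length `2b`.
  have h2 := (convex_Icc (-b) b).norm_image_sub_le_of_norm_hasDerivWithin_le
    (f := fun β => rootDens u s β - β * rootDensDeriv u s 0)
    (f' := fun β => rootDensDeriv u s β - rootDensDeriv u s 0)
    (fun x hx => by
      have hx' : 0 < 1 + 4 * x * (u + x * s) := by linarith [dom x hx]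
      have := (hasDerivAt_rootDens hx').sub
        ((hasDerivAt_id x).mul_const (rootDensDeriv u s 0))
      convert! this.hasDerivWithinAt using 1
      simp) hstep
    (x := -b) (y := b) ⟨le_rfl, by linarith⟩ ⟨by linarith, le_rfl⟩
  rw [h0, Real.norm_eq_abs, Real.norm_eq_abs, show b - -b = 2 * b by ring,
    abs_of_nonneg (by positivity : 0 ≤ 2 * b)] at h2
  calc _ = |rootDens u s b - b * (gaussDens u * u * (u ^ 2 - s - 2))
        - (rootDens u s (-b) - -b * (gaussDens u * u * (u ^ 2 - s - 2)))| := by congr 1; ring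
    _ ≤ _ := h2
    _ = _ := by ring

/-- The second order effect of `s` on the normal tail probabilities beyond the two roots. -/
lemma abs_gaussPrim_quadRoot_sub_le (hb : 0 ≤ b) (hbs : b * (1 + |s|) ≤ 1 / 16) (hu : 0 ≤ u)
    (hbu : b * u ≤ 1 / 16) :
    |(gaussPrim (quadRoot b u 0) + gaussPrim (quadRoot (-b) u 0))
      - (gaussPrim (quadRoot b u s) + gaussPrim (quadRoot (-b) u s))
      - b ^ 2 * (gaussDens u * u * (s ^ 2 + 4 * s - 2 * u ^ 2 * s))|
      ≤ 1597440 * b ^ 3 * (1 + |s|) ^ 3 := by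
  have hS : ∀ x ∈ Set.Icc (-|s|) |s|, b * (1 + |x|) ≤ 1 / 16 := fun x hx => by
    have : |x| ≤ |s| := abs_le.2 hx
    refine le_trans ?_ hbs
    gcongr
  -- The `s`-derivative of each `gaussPrim` term is `±b` times `rootDens` at `±b`, so the previous
  -- bound is integrated from `0` to `s`. The symmetric interval serves both signs of `s`.
  have h2 := (convex_Icc (-|s|) |s|).norm_image_sub_le_of_norm_hasDerivWithin_le
    (C := 1597440 * b ^ 3 * (1 + |s|) ^ 2)
    (f := fun x => -(gaussPrim (quadRoot b u x) + gaussPrim (quadRoot (-b) u x))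
      - b ^ 2 * (gaussDens u * u * (x ^ 2 + 4 * x - 2 * u ^ 2 * x)))
    (f' := fun x => -b * (rootDens u x b - rootDens u x (-b)
      - 2 * b * (gaussDens u * u * (u ^ 2 - x - 2))))
    (fun x hx => ?_) (fun x hx => ?_)
    (x := 0) (y := s) ⟨by simp, by simp⟩ ⟨neg_abs_le s, le_abs_self s⟩
  · simp only [Real.norm_eq_abs, sub_zero] at h2
    calc _ = _ := by congr 1; ring
      _ ≤ _ := h2
      _ ≤ 1597440 * b ^ 3 * (1 + |s|) ^ 2 * (1 + |s|) := by gcongr; linarith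
      _ = _ := by ring
  · have d1 : 0 < 1 + 4 * b * (u + b * x) := by
      linarith [quarter_le_disc hb (hS x hx) hu hbu (β := b) (abs_of_nonneg hb).le]
    have d2 : 0 < 1 + 4 * (-b) * (u + (-b) * x) := by
      linarith [quarter_le_disc hb (hS x hx) hu hbu (β := -b) (by rw [abs_neg, abs_of_nonneg hb])]
    have e1 := (hasDerivAt_gaussPrim _).comp x (hasDerivAt_quadRoot_right d1)
    have e2 := (hasDerivAt_gaussPrim _).comp x (hasDerivAt_quadRoot_right d2)
    have e3 : HasDerivAt (fun x => b ^ 2 * (gaussDens u * u * (x ^ 2 + 4 * x - 2 * u ^ 2 * x)))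
        (b ^ 2 * (gaussDens u * u * (2 * x + 4 - 2 * u ^ 2))) x := by
      have := ((((hasDerivAt_pow 2 x).add ((hasDerivAt_id x).const_mul 4)).sub
        ((hasDerivAt_id x).const_mul (2 * u ^ 2))).const_mul (gaussDens u * u)).const_mul (b ^ 2)
      convert! this using 1
      simp
    convert! ((e1.add e2).neg.sub e3).hasDerivWithinAt using 1
    simp only [rootDens, div_eq_mul_inv]
    ring
  · rw [norm_mul, norm_neg, Real.norm_of_nonneg hb, Real.norm_eq_abs]
    have hxs : |x| ≤ |s| := abs_le.2 hx
    calc _ ≤ b * (1597440 * b ^ 2 * (1 + |x|) ^ 2) := by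
          gcongr; exact abs_rootDens_sub_le hb (hS x hx) hu hbu
      _ ≤ b * (1597440 * b ^ 2 * (1 + |s|) ^ 2) := by gcongr
      _ = _ := by ring

end Taylor

/-! ### Tail probabilities of a quadratic in a normal variable. -/

/-- The probability that `|Z + b(Z² - s)| ≥ u` for a standard normal `Z`. -/
noncomputable def quadTail (b u s : ℝ) : ℝ :=
  (gaussianReal 0 1).real {z | u ≤ |z + b * (z ^ 2 - s)|}

/-- The probability that `Z + b(Z² - s) ≥ u` for a standard normal `Z`. -/
noncomputable def quadTailRight (b u s : ℝ) : ℝ :=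
  (gaussianReal 0 1).real {z | u ≤ z + b * (z ^ 2 - s)}

lemma integrable_pow_gaussianReal (k : ℕ) : Integrable (fun z : ℝ => z ^ k) (gaussianReal 0 1) := by
  have := (memLp_id_gaussianReal (μ := 0) (v := 1) (k : ℝ≥0)).integrable_norm_pow'
  refine this.mono (by fun_prop) (ae_of_all _ fun z => ?_)
  simp

/-- Markov's inequality with the fourth moment: thresholds of order `1/b` cost only `O(b⁴)`. -/
lemma gaussianReal_abs_ge_le {x : ℝ} (hx : 0 < x) :
    (gaussianReal 0 1).real {z | x ≤ |z|} ≤ (∫ z, z ^ 4 ∂(gaussianReal 0 1)) / x ^ 4 := by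
  rw [le_div_iff₀ (by positivity), mul_comm]
  have := mul_meas_ge_le_integral_of_nonneg (μ := gaussianReal 0 1) (f := fun z : ℝ => z ^ 4)
    (ae_of_all _ fun z => by positivity) (integrable_pow_gaussianReal 4) (x ^ 4)
  refine le_trans ?_ this
  refine mul_le_mul_of_nonneg_left (measureReal_mono fun z (hz : x ≤ |z|) => ?_) (by positivity)
  have h4 : x ^ 4 ≤ |z| ^ 4 := by gcongr
  rwa [Even.pow_abs (by decide)] at h4

/-- The reflection `z ↦ -z` turns the lower tail for `b` into the upper tail for `-b`. -/
lemma quadTail_eq_add {u : ℝ} (hu : 0 < u) (b s : ℝ) :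
    quadTail b u s = quadTailRight b u s + quadTailRight (-b) u s := by
  have h1 : quadTailRight (-b) u s
      = (gaussianReal 0 1).real {z | z + b * (z ^ 2 - s) ≤ -u} := by
    unfold quadTailRight
    have hm : (gaussianReal 0 1).map (fun x : ℝ => -x) = gaussianReal 0 1 := by
      simpa using gaussianReal_map_neg (μ := 0) (v := 1)
    rw [← hm, map_measureReal_apply (by fun_prop) (measurableSet_le (by fun_prop) (by fun_prop)),
      hm]
    congr 1
    ext z
    simp only [Set.mem_preimage, Set.mem_ofPred_eq]
    constructor <;> intro h <;> nlinarith
  rw [h1, quadTail, quadTailRight, ← measureReal_union]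
  · congr 1
    ext z
    simp only [Set.mem_union, Set.mem_ofPred_eq, le_abs]
    constructor
    · rintro (h | h)
      · exact Or.inl h
      · right; linarith
    · rintro (h | h)
      · exact Or.inl h
      · right; linarith
  · rw [Set.disjoint_left]
    intro z h1 h2
    simp only [Set.mem_ofPred_eq] at h1 h2
    linarith
  · exact measurableSet_le (by fun_prop) (by fun_prop)

/-- The event differs from the half-line beyond the root only where `|z| ≥ 1/(2|b|)`, the region of
the second branch of the parabola. -/
lemma abs_quadTailRight_sub_le {b u s : ℝ} (hb : b ≠ 0) (h : 0 < 1 + 4 * b * (u + b * s)) :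
    |quadTailRight b u s - (1 / 2 - gaussPrim (quadRoot b u s))|
      ≤ 16 * (∫ z, z ^ 4 ∂(gaussianReal 0 1)) * b ^ 4 := by
  have hx : 0 < 1 / (2 * |b|) := by positivity
  rw [← gaussianReal_real_Ici, quadTailRight]
  refine (abs_measureReal_sub_le_measureReal_symmDiff
    (measurableSet_le (f := fun _ : ℝ => u) (g := fun z : ℝ => z + b * (z ^ 2 - s))
      (by fun_prop) (by fun_prop)).nullMeasurableSet measurableSet_Ici.nullMeasurableSet).trans ?_
  refine (measureReal_mono ?_).trans ((gaussianReal_abs_ge_le hx).trans_eq ?_)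
  · intro z hz
    by_contra hlt
    simp only [Set.mem_ofPred_eq, not_le] at hlt
    rw [lt_div_iff₀ (by positivity)] at hlt
    have := le_quad_iff h (z := z) (by linarith)
    simp only [Set.mem_symmDiff, Set.mem_ofPred_eq, Set.mem_Ici, this] at hz
    tauto
  · have : |b| ^ 4 = b ^ 4 := by rw [← abs_pow]; exact abs_of_nonneg (by positivity)
    rw [div_pow, mul_pow, this]
    field_simp
    norm_num

lemma gaussDens_mul_abs_quad_le (u s : ℝ) {k : ℕ} (hk : k ≤ 3) :
    gaussDens u * |u| ^ k * |s ^ 2 + 4 * s - 2 * u ^ 2 * s| ≤ 2304 * (1 + |s|) ^ 2 := by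
  have h1 := gaussDens_mul_pow_le u (k := k) (by omega)
  have h2 := gaussDens_mul_pow_le u (k := k + 2) (by omega)
  have h0 := gaussDens_pos u
  have h3 : |s ^ 2 + 4 * s - 2 * u ^ 2 * s| ≤ s ^ 2 + 4 * |s| + 2 * |u| ^ 2 * |s| := by
    have := abs_sub (s ^ 2 + 4 * s) (2 * u ^ 2 * s)
    have e := abs_add_le (s ^ 2) (4 * s)
    rw [abs_mul (4 : ℝ), abs_of_nonneg (sq_nonneg s), abs_of_pos (by norm_num : (0 : ℝ) < 4)] at e
    rw [abs_mul, abs_mul, abs_of_pos (by norm_num : (0 : ℝ) < 2), abs_pow] at this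
    linarith
  calc gaussDens u * |u| ^ k * |s ^ 2 + 4 * s - 2 * u ^ 2 * s|
      ≤ gaussDens u * |u| ^ k * (s ^ 2 + 4 * |s| + 2 * |u| ^ 2 * |s|) := by gcongr
    _ = (gaussDens u * |u| ^ k) * (s ^ 2 + 4 * |s|) + (gaussDens u * |u| ^ (k + 2)) * (2 * |s|) := by
        ring
    _ ≤ 768 * (s ^ 2 + 4 * |s|) + 768 * (2 * |s|) := by gcongr
    _ ≤ 2304 * (1 + |s|) ^ 2 := by nlinarith [sq_abs s, abs_nonneg s]

lemma quadTail_nonneg (b u s : ℝ) : 0 ≤ quadTail b u s := measureReal_nonneg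

lemma quadTail_le_one (b u s : ℝ) : quadTail b u s ≤ 1 := measureReal_le_one

/-- Here the event forces `|z| ≥ 1/(64b)`, and `64⁴ = 16777216`. -/
lemma quadTail_le_of_large {b u s : ℝ} (hb : 0 < b) (hbs : b * (1 + |s|) ≤ 1 / 16)
    (hbu : 1 / 16 < b * u) :
    quadTail b u s ≤ 16777216 * (∫ z, z ^ 4 ∂(gaussianReal 0 1)) * b ^ 4 := by
  have hx : 0 < 1 / (64 * b) := by positivity
  refine (measureReal_mono ?_).trans ((gaussianReal_abs_ge_le hx).trans_eq ?_)
  · intro z hz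
    by_contra hlt
    simp only [Set.mem_ofPred_eq, not_le] at hz hlt
    rw [lt_div_iff₀ (by positivity)] at hlt
    have h1 : |z + b * (z ^ 2 - s)| ≤ |z| + b * (|z| ^ 2 + |s|) := by
      have e1 := abs_add_le z (b * (z ^ 2 - s))
      have e2 := abs_sub (z ^ 2) s
      rw [abs_mul, abs_of_pos hb] at e1
      rw [abs_pow] at e2
      nlinarith
    have h2 : b * u ≤ b * |z| + (b * |z|) ^ 2 + b * (b * |s|) := by
      calc b * u ≤ b * (|z| + b * (|z| ^ 2 + |s|)) := by gcongr; linarith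
        _ = _ := by ring
    have h3 : b * |z| ≤ 1 / 64 := by linarith
    have h4 : (b * |z|) ^ 2 ≤ (1 / 64) ^ 2 := by gcongr
    have h5 : b ≤ 1 / 16 := by nlinarith [abs_nonneg s]
    have h6 : b * |s| ≤ 1 / 16 := by nlinarith
    have h7 : b * (b * |s|) ≤ 1 / 16 * (1 / 16) := by gcongr
    norm_num at h4 h7
    linarith
  · field_simp
    norm_num

/-- Three regimes, with `y = b(1+|s|)`. If `y > 1/16`, the error term dominates everything. If `y`
is small but `bu > 1/16`, both tails are `O(b⁴)` and the main term is negligible. Otherwise the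
expansion at the roots applies. -/
lemma exists_abs_quadTail_sub_le : ∃ C, 0 ≤ C ∧ ∀ b u s : ℝ, 0 < b → 0 < u →
    |quadTail b u s - quadTail b u 0 - b ^ 2 * (gaussDens u * u * (s ^ 2 + 4 * s - 2 * u ^ 2 * s))|
      ≤ C * (b ^ 3 * (1 + |s|) ^ 3) := by
  set m := ∫ z, z ^ 4 ∂(gaussianReal 0 1)
  have hm : 0 ≤ m := integral_nonneg fun z => by positivity
  refine ⟨2000000 + 16777216 * m, by positivity, fun b u s hb hu => ?_⟩
  set y := b * (1 + |s|) with hy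
  have hy0 : 0 < y := by positivity
  have hby : b ≤ y := by nlinarith [abs_nonneg s]
  have hgoal : b ^ 3 * (1 + |s|) ^ 3 = y ^ 3 := by rw [hy]; ring
  have hgu := gaussDens_pos u
  have hpoly : |gaussDens u * u * (s ^ 2 + 4 * s - 2 * u ^ 2 * s)| ≤ 2304 * (1 + |s|) ^ 2 := by
    rw [abs_mul, abs_mul, abs_of_pos hgu]
    simpa using gaussDens_mul_abs_quad_le u s (k := 1) (by norm_num)
  have hpoly' : u * |gaussDens u * u * (s ^ 2 + 4 * s - 2 * u ^ 2 * s)| ≤ 2304 * (1 + |s|) ^ 2 := by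
    have := gaussDens_mul_abs_quad_le u s (k := 2) (by norm_num)
    rw [abs_mul, abs_mul, abs_of_pos hgu, abs_of_pos hu]
    rw [abs_of_pos hu] at this
    linarith
  have hb4 : y ≤ 1 → b ^ 4 ≤ y ^ 3 := fun h => by
    calc b ^ 4 ≤ y ^ 4 := by gcongr
      _ = y ^ 3 * y := by ring
      _ ≤ y ^ 3 * 1 := by gcongr
      _ = _ := by ring
  have hdiff : |quadTail b u s - quadTail b u 0| ≤ 1 := by
    rw [abs_le]
    constructor <;> linarith [quadTail_nonneg b u s, quadTail_nonneg b u 0, quadTail_le_one b u s,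
      quadTail_le_one b u 0]
  have htri := abs_sub (quadTail b u s - quadTail b u 0)
    (b ^ 2 * (gaussDens u * u * (s ^ 2 + 4 * s - 2 * u ^ 2 * s)))
  rw [abs_mul (b ^ 2), abs_of_pos (by positivity : 0 < b ^ 2)] at htri
  set q := |gaussDens u * u * (s ^ 2 + 4 * s - 2 * u ^ 2 * s)|
  have hmy : 0 ≤ m * y ^ 3 := by positivity
  rw [hgoal]
  rcases lt_or_ge (1 / 16) y with h1 | h1
  · have hq : b ^ 2 * q ≤ 2304 * y ^ 2 := by
      calc b ^ 2 * q ≤ b ^ 2 * (2304 * (1 + |s|) ^ 2) := by gcongr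
        _ = _ := by rw [hy]; ring
    have h2 : y ^ 2 ≤ 16 * y ^ 3 := by nlinarith [sq_nonneg y]
    have h3 : 1 ≤ 256 * y ^ 2 := by nlinarith
    nlinarith
  · have hbs0 : b * (1 + |(0 : ℝ)|) ≤ 1 / 16 := by simp; linarith
    have hb4' := hb4 (by linarith)
    have hmb : m * b ^ 4 ≤ m * y ^ 3 := by gcongr
    rcases lt_or_ge (1 / 16) (b * u) with h2 | h2
    · have e1 := quadTail_le_of_large hb h1 h2
      have e2 := quadTail_le_of_large hb hbs0 h2
      have e3 : |quadTail b u s - quadTail b u 0| ≤ 16777216 * m * b ^ 4 := by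
        rw [abs_le]
        constructor <;> linarith [quadTail_nonneg b u s, quadTail_nonneg b u 0]
      -- Since `1 < 16bu`, the main term gains a factor `b` at the price of one more power of `u`,
      -- which the density absorbs.
      have e4 : b ^ 2 * q ≤ 36864 * y ^ 3 := by
        have : q ≤ 16 * b * (2304 * (1 + |s|) ^ 2) := by
          have hq0 : 0 ≤ q := abs_nonneg _
          calc q = 16 * (1 / 16) * q := by ring
            _ ≤ 16 * (b * u) * q := by gcongr
            _ = 16 * b * (u * q) := by ring
            _ ≤ _ := by gcongr
        calc b ^ 2 * q ≤ b ^ 2 * (16 * b * (2304 * (1 + |s|) ^ 2)) := by gcongr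
          _ = 36864 * (b ^ 3 * (1 + |s|) ^ 2 * 1) := by ring
          _ ≤ 36864 * (b ^ 3 * (1 + |s|) ^ 2 * (1 + |s|)) := by
              gcongr; linarith [abs_nonneg s]
          _ = _ := by rw [hy]; ring
      have hy3 : 0 < y ^ 3 := by positivity
      nlinarith
    · have key := abs_gaussPrim_quadRoot_sub_le hb.le h1 hu.le h2
      have abs_b : |b| ≤ b := (abs_of_pos hb).le
      have abs_nb : |-b| ≤ b := by rw [abs_neg]; exact abs_b
      have approx : ∀ β x : ℝ, β ≠ 0 → |β| ≤ b → b * (1 + |x|) ≤ 1 / 16 →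
          |quadTailRight β u x - (1 / 2 - gaussPrim (quadRoot β u x))| ≤ 16 * m * β ^ 4 :=
        fun β x h0 hβ hx => abs_quadTailRight_sub_le h0 (by
          linarith [quarter_le_disc hb.le hx hu.le h2 hβ])
      have a1 := approx b s hb.ne' abs_b h1
      have a2 := approx (-b) s (neg_ne_zero.2 hb.ne') abs_nb h1
      have a3 := approx b 0 hb.ne' abs_b hbs0
      have a4 := approx (-b) 0 (neg_ne_zero.2 hb.ne') abs_nb hbs0
      rw [show (-b) ^ 4 = b ^ 4 by ring] at a2 a4
      rw [quadTail_eq_add hu, quadTail_eq_add hu]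
      rw [show 1597440 * b ^ 3 * (1 + |s|) ^ 3 = 1597440 * y ^ 3 by rw [hy]; ring] at key
      have hy3 : 0 < y ^ 3 := by positivity
      rw [abs_le] at a1 a2 a3 a4 key ⊢
      constructor <;> linarith [a1.1, a1.2, a2.1, a2.2, a3.1, a3.2, a4.1, a4.2, key.1, key.2]

/-! ### The telescoping primitive. -/

/-- The primitive `M(u) = (d² + 2d) G(u) + 2d u φ(u)` of `(d² + 4d - 2d u²) φ(u)`. -/
noncomputable def gainPrim (d u : ℝ) : ℝ :=
  (d ^ 2 + 2 * d) * gaussPrim u + 2 * d * (u * gaussDens u)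

lemma hasDerivAt_gainPrim (d u : ℝ) :
    HasDerivAt (gainPrim d) (gaussDens u * (d ^ 2 + 4 * d - 2 * d * u ^ 2)) u := by
  have := ((hasDerivAt_gaussPrim u).const_mul (d ^ 2 + 2 * d)).add
    (((hasDerivAt_id u).mul (hasDerivAt_gaussDens u)).const_mul (2 * d))
  convert! this using 1
  simp; ring

lemma gainPrim_zero (d : ℝ) : gainPrim d 0 = 0 := by simp [gainPrim, gaussPrim_zero]

lemma continuous_gainPrim (d : ℝ) : Continuous (gainPrim d) :=
  continuous_iff_continuousAt.2 fun u => (hasDerivAt_gainPrim d u).continuousAt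

lemma tendsto_gainPrim (d : ℝ) : Tendsto (gainPrim d) atTop (𝓝 ((d ^ 2 + 2 * d) / 2)) := by
  have h1 : Tendsto (fun u : ℝ => u * gaussDens u) atTop (𝓝 0) := by
    have hlim : Tendsto (fun u : ℝ => 768 / u) atTop (𝓝 0) :=
      tendsto_const_nhds.div_atTop tendsto_id
    refine squeeze_zero' ?_ ?_ hlim
    · filter_upwards [eventually_gt_atTop 0] with u hu
      have := gaussDens_pos u
      positivity
    · filter_upwards [eventually_gt_atTop 0] with u hu
      have := gaussDens_mul_pow_le u (k := 2) (by norm_num)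
      rw [abs_of_pos hu] at this
      rw [le_div_iff₀ hu]
      linarith
  have := (tendsto_gaussPrim.const_mul (d ^ 2 + 2 * d)).add (h1.const_mul (2 * d))
  convert! this using 2
  ring

/-- First-order Taylor expansion of `x ↦ M(κ√x)` over a unit step. Its second derivative is `x⁻²`
times a combination of `φ(u)uᵏ` with `u = κ√x`, so the constant does not depend on `κ`; this is
needed because `κ` is proportional to `ε`. -/
lemma exists_abs_gainPrim_sub_le (d : ℝ) : ∃ C, 0 ≤ C ∧ ∀ κ x : ℝ, 0 < κ → 0 < x →
    |gainPrim d (κ * √(x + 1)) - gainPrim d (κ * √x)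
      - gaussDens (κ * √x) * (d ^ 2 + 4 * d - 2 * d * (κ * √x) ^ 2) * (κ * √x) / (2 * x)|
      ≤ C / x ^ 2 := by
  set A := |d ^ 2 + 4 * d|
  set B := 2 * |d|
  refine ⟨768 * (2 * A + 4 * B), by positivity, fun κ x hκ hx => ?_⟩
  set m : ℝ → ℝ := fun u => gaussDens u * (d ^ 2 + 4 * d - 2 * d * u ^ 2) * u with hm
  set F' : ℝ → ℝ := fun y => m (κ * √y) / (2 * y) with hF'
  have hu : ∀ y, 0 < y → HasDerivAt (fun y => κ * √y) (κ * √y / (2 * y)) y := fun y hy => by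
    convert! ((hasDerivAt_id y).sqrt hy.ne').const_mul κ using 1
    have h1 : √y ≠ 0 := by positivity
    have h2 : y = √y ^ 2 := (Real.sq_sqrt hy.le).symm
    simp only [id]
    field_simp
    rw [← h2]
  have hF : ∀ y, 0 < y → HasDerivAt (fun y => gainPrim d (κ * √y)) (F' y) y := fun y hy => by
    convert! (hasDerivAt_gainPrim d (κ * √y)).comp y (hu y hy) using 1
    simp only [hF', hm]; ring
  have hmd : ∀ u, HasDerivAt m (gaussDens u * (d ^ 2 + 4 * d - 2 * d * u ^ 2)
      + u * (gaussDens u * (-4 * d * u) - u * gaussDens u * (d ^ 2 + 4 * d - 2 * d * u ^ 2))) u := by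
    intro u
    have := ((hasDerivAt_gaussDens u).mul
      (((hasDerivAt_pow 2 u).const_mul (2 * d)).const_sub (d ^ 2 + 4 * d))).mul (hasDerivAt_id u)
    convert! this using 1
    simp; ring
  have hF2 : ∀ y, 0 < y → ∃ K, HasDerivAt F' K y ∧ |K| ≤ 768 * (2 * A + 4 * B) / y ^ 2 := by
    intro y hy
    have h1 := ((hmd (κ * √y)).comp y (hu y hy)).div ((hasDerivAt_id y).const_mul 2)
      (by simp; positivity)
    refine ⟨_, h1, ?_⟩
    simp only [Function.comp, id]
    set u := κ * √y
    have hup : 0 < u := by positivity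
    have hg := gaussDens_pos u
    have b1 := gaussDens_mul_pow_le u (k := 1) (by norm_num)
    have b3 := gaussDens_mul_pow_le u (k := 3) (by norm_num)
    have b5 := gaussDens_mul_pow_le u (k := 5) (by norm_num)
    rw [abs_of_pos hup] at b1 b3 b5
    have hmu : m u = gaussDens u * (d ^ 2 + 4 * d - 2 * d * u ^ 2) * u := rfl
    set g := gaussDens u
    clear_value u g
    have e : ((g * (d ^ 2 + 4 * d - 2 * d * u ^ 2) + u * (g * (-4 * d * u)
        - u * g * (d ^ 2 + 4 * d - 2 * d * u ^ 2))) * (u / (2 * y)) * (2 * y) - m u * (2 * 1))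
          / (2 * y) ^ 2 = ((d ^ 2 + 4 * d) * (-(g * u ^ 1) - g * u ^ 3)
            + (2 * d) * (-(g * u ^ 3) + g * u ^ 5)) / (4 * y ^ 2) := by
      have hy' := hy.ne'
      rw [hmu]
      field_simp
      ring
    rw [e, abs_div, abs_of_pos (by positivity : 0 < 4 * y ^ 2)]
    have p1 : 0 ≤ g * u ^ 1 := by positivity
    have p3 : 0 ≤ g * u ^ 3 := by positivity
    have p5 : 0 ≤ g * u ^ 5 := by positivity
    have c1 : |-(g * u ^ 1) - g * u ^ 3| ≤ 1536 := by rw [abs_le]; constructor <;> linarith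
    have c2 : |-(g * u ^ 3) + g * u ^ 5| ≤ 1536 := by rw [abs_le]; constructor <;> linarith
    have c3 : |(d ^ 2 + 4 * d) * (-(g * u ^ 1) - g * u ^ 3) + 2 * d * (-(g * u ^ 3) + g * u ^ 5)|
        ≤ A * 1536 + B * 1536 := by
      refine (abs_add_le _ _).trans ?_
      rw [abs_mul, abs_mul (2 * d), abs_mul 2 d, abs_of_pos (by norm_num : (0 : ℝ) < 2)]
      gcongr
    have hA0 : 0 ≤ A := abs_nonneg _
    have hB0 : 0 ≤ B := by positivity
    calc _ ≤ (A * 1536 + B * 1536) / (4 * y ^ 2) := by gcongr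
      _ ≤ (4 * (768 * (2 * A + 4 * B))) / (4 * y ^ 2) := by gcongr; linarith
      _ = _ := by rw [mul_div_mul_left _ _ (by norm_num)]
  choose! K hK hKb using hF2
  have hpos : ∀ y ∈ Set.Icc x (x + 1), 0 < y := fun y hy => hx.trans_le hy.1
  have hxm : x ∈ Set.Icc x (x + 1) := ⟨le_rfl, by linarith⟩
  set C := 768 * (2 * A + 4 * B)
  have hC : 0 ≤ C := by positivity
  have hstep : ∀ y ∈ Set.Icc x (x + 1), ‖F' y - F' x‖ ≤ C / x ^ 2 := fun y hy => by
    refine ((convex_Icc x (x + 1)).norm_image_sub_le_of_norm_hasDerivWithin_le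
      (C := C / x ^ 2) (fun z hz => (hK z (hpos z hz)).hasDerivWithinAt) (fun z hz => ?_)
      hxm hy).trans ?_
    · refine (hKb z (hpos z hz)).trans ?_
      gcongr
      exact hz.1
    · refine mul_le_of_le_one_right (by positivity) ?_
      rw [Real.norm_eq_abs, abs_of_nonneg (by linarith [hy.1])]
      linarith [hy.2]
  have h2 := (convex_Icc x (x + 1)).norm_image_sub_le_of_norm_hasDerivWithin_le
    (f := fun y => gainPrim d (κ * √y) - y * F' x) (f' := fun y => F' y - F' x)
    (fun y hy => by
      have := (hF y (hpos y hy)).sub ((hasDerivAt_id y).mul_const (F' x))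
      convert! this.hasDerivWithinAt using 1
      simp) hstep hxm (y := x + 1) ⟨by linarith, le_rfl⟩
  rw [add_sub_cancel_left, norm_one, mul_one, Real.norm_eq_abs] at h2
  refine le_trans (le_of_eq ?_) h2
  congr 1
  simp only [hF', hm]
  ring

/-! ### Law and independence of the sample mean and sample variance. -/

/-- The standardized mean `√n` times the sample mean. -/
noncomputable def stdMean (x : ℕ → ℝ) (n : ℕ) : ℝ := √(n : ℝ) * sampleMean x n

lemma sampleVar_nonneg (x : ℕ → ℝ) {n : ℕ} (hn : 2 ≤ n) : 0 ≤ sampleVar x n := by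
  have : (2 : ℝ) ≤ n := by exact_mod_cast hn
  unfold sampleVar
  apply div_nonneg (Finset.sum_nonneg fun i _ => sq_nonneg _)
  linarith

lemma sampleVar_eq (x : ℕ → ℝ) {n : ℕ} (hn : 2 ≤ n) :
    sampleVar x n
      = (∑ i ∈ Finset.range n, x i ^ 2 - stdMean x n ^ 2) / ((n : ℝ) - 1) := by
  have h0 : (n : ℝ) ≠ 0 := by positivity
  have h1 : ∑ i ∈ Finset.range n, x i = n * sampleMean x n := by
    unfold sampleMean; field_simp
  unfold sampleVar
  congr 1
  simp_rw [sub_sq, Finset.sum_add_distrib, Finset.sum_sub_distrib, ← Finset.sum_mul,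
    ← Finset.mul_sum, h1]
  simp only [Finset.sum_const, Finset.card_range, nsmul_eq_mul]
  rw [stdMean, mul_pow, Real.sq_sqrt (by positivity)]
  ring

/-- Independent standard normal observations. -/
structure IsStdNormalSample {Ω : Type*} [MeasurableSpace Ω] (Y : ℕ → Ω → ℝ) (P : Measure Ω) :
    Prop where
  indep : iIndepFun Y P
  law : ∀ i, HasLaw (Y i) (gaussianReal 0 1) P

namespace IsStdNormalSample

variable {Ω : Type*} [MeasurableSpace Ω] {P : Measure Ω} {Y : ℕ → Ω → ℝ}

lemma aemeasurable (h : IsStdNormalSample Y P) (i : ℕ) : AEMeasurable (Y i) P :=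
  (h.law i).aemeasurable

lemma memLp_two (h : IsStdNormalSample Y P) (i : ℕ) : MemLp (Y i) 2 P :=
  (h.law i).hasGaussianLaw.memLp_two

lemma integral_eq (h : IsStdNormalSample Y P) (i : ℕ) : ∫ ω, Y i ω ∂P = 0 := by
  rw [(h.law i).integral_eq]; simp

lemma variance_eq (h : IsStdNormalSample Y P) (i : ℕ) : Var[Y i; P] = 1 := by
  rw [(h.law i).variance_eq]; simp

lemma integral_pow (h : IsStdNormalSample Y P) (i k : ℕ) :
    ∫ ω, Y i ω ^ k ∂P = ∫ z, z ^ k ∂(gaussianReal 0 1) :=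
  (h.law i).integral_comp (f := fun z : ℝ => z ^ k) (by fun_prop)

lemma integrable_pow (h : IsStdNormalSample Y P) (i k : ℕ) :
    Integrable (fun ω => Y i ω ^ k) P := by
  have := (integrable_pow_gaussianReal k)
  rw [← (h.law i).map_eq] at this
  exact this.comp_aemeasurable (h.aemeasurable i)

lemma covariance_eq (h : IsStdNormalSample Y P) (i j : ℕ) :
    cov[Y i, Y j; P] = if i = j then 1 else 0 := by
  split_ifs with hij
  · subst hij
    rw [covariance_self (h.aemeasurable i), h.variance_eq]
  · exact (h.indep.indepFun hij).covariance_eq_zero (h.memLp_two i) (h.memLp_two j)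

lemma aemeasurable_sampleMean (h : IsStdNormalSample Y P) (n : ℕ) :
    AEMeasurable (fun ω => sampleMean (fun i => Y i ω) n) P := by
  have := h.aemeasurable
  unfold sampleMean
  fun_prop

/-- The mean and the deviations are a linear image of a Gaussian vector. The mean is indexed by
`Unit` to fit the criterion of independence for two Gaussian families. -/
lemma hasGaussianLaw_sampleMean_sub (h : IsStdNormalSample Y P) (n : ℕ) :
    HasGaussianLaw (fun ω => ((fun _ : Unit => sampleMean (fun i => Y i ω) n),
      (fun j : Fin n => Y j ω - sampleMean (fun i => Y i ω) n))) P := by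
  have h1 : iIndepFun (fun i : Fin n => Y i) P := h.indep.precomp Fin.val_injective
  have h2 : HasGaussianLaw (fun ω (i : Fin n) => Y i ω) P :=
    h1.hasGaussianLaw fun i => (h.law i).hasGaussianLaw
  let M : (Fin n → ℝ) →L[ℝ] ℝ :=
    (n : ℝ)⁻¹ • ∑ i : Fin n, ContinuousLinearMap.proj (R := ℝ) (φ := fun _ : Fin n => ℝ) i
  let L : (Fin n → ℝ) →L[ℝ] (Unit → ℝ) × (Fin n → ℝ) :=
    (ContinuousLinearMap.pi fun _ => M).prod
      (ContinuousLinearMap.pi fun j => ContinuousLinearMap.proj j - M)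
  have h3 := h2.map_fun L
  convert! h3 using 1
  ext ω j <;> simp [L, M, sampleMean, Finset.sum_range, div_eq_inv_mul]

lemma aemeasurable_sampleVar (h : IsStdNormalSample Y P) (n : ℕ) :
    AEMeasurable (fun ω => sampleVar (fun i => Y i ω) n) P := by
  have := h.aemeasurable
  have := h.aemeasurable_sampleMean n
  unfold sampleVar
  fun_prop

lemma hasGaussianLaw_sampleMean (h : IsStdNormalSample Y P) (n : ℕ) :
    HasGaussianLaw (fun ω => sampleMean (fun i => Y i ω) n) P :=
  (h.hasGaussianLaw_sampleMean_sub n).fst.eval ()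

variable [IsProbabilityMeasure P]

lemma covariance_sampleMean (h : IsStdNormalSample Y P) {n j : ℕ} (hj : j < n) :
    cov[fun ω => sampleMean (fun i => Y i ω) n, Y j; P] = (n : ℝ)⁻¹ := by
  have e : (fun ω => sampleMean (fun i => Y i ω) n)
      = fun ω => (n : ℝ)⁻¹ * ∑ i ∈ Finset.range n, Y i ω := by
    ext ω; simp [sampleMean, div_eq_inv_mul]
  rw [e, covariance_const_mul_left,
    covariance_fun_sum_left' (fun i _ => h.memLp_two i) (h.memLp_two j)]
  simp_rw [h.covariance_eq]
  simp [hj]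

lemma variance_sampleMean (h : IsStdNormalSample Y P) {n : ℕ} (hn : 0 < n) :
    Var[fun ω => sampleMean (fun i => Y i ω) n; P] = (n : ℝ)⁻¹ := by
  rw [← covariance_self (h.aemeasurable_sampleMean n)]
  have e : (fun ω => sampleMean (fun i => Y i ω) n)
      = fun ω => (n : ℝ)⁻¹ * ∑ i ∈ Finset.range n, Y i ω := by
    ext ω; simp [sampleMean, div_eq_inv_mul]
  nth_rw 2 [e]
  rw [covariance_const_mul_right, covariance_fun_sum_right' (fun i _ => h.memLp_two i)
    (h.hasGaussianLaw_sampleMean n).memLp_two,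
    Finset.sum_congr rfl fun i hi => h.covariance_sampleMean (Finset.mem_range.1 hi)]
  have : (n : ℝ) ≠ 0 := by positivity
  simp [this]

lemma hasLaw_stdMean (h : IsStdNormalSample Y P) {n : ℕ} (hn : 0 < n) :
    HasLaw (fun ω => stdMean (fun i => Y i ω) n) (gaussianReal 0 1) P := by
  have hg : HasGaussianLaw (fun ω => stdMean (fun i => Y i ω) n) P :=
    (h.hasGaussianLaw_sampleMean n).fun_smul (√(n : ℝ))
  refine ⟨hg.aemeasurable, ?_⟩
  rw [hg.map_eq_gaussianReal]
  have hn' : (n : ℝ) ≠ 0 := by positivity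
  have hmean : ∫ ω, stdMean (fun i => Y i ω) n ∂P = 0 := by
    unfold stdMean sampleMean
    rw [integral_const_mul, integral_div, integral_finsetSum _ fun i _ =>
      (h.memLp_two i).integrable (by norm_num)]
    simp [h.integral_eq]
  have hvar : Var[fun ω => stdMean (fun i => Y i ω) n; P] = 1 := by
    unfold stdMean
    rw [variance_const_mul, h.variance_sampleMean hn, Real.sq_sqrt (by positivity),
      mul_inv_cancel₀ hn']
  rw [hmean, hvar]
  simp

/-- The mean is uncorrelated with each deviation, both covariances being `1/n`; joint normality
makes it independent of the whole vector of deviations, of which the sample variance is a function.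
-/
lemma indepFun_stdMean_sampleVar (h : IsStdNormalSample Y P) (n : ℕ) :
    IndepFun (fun ω => stdMean (fun i => Y i ω) n) (fun ω => sampleVar (fun i => Y i ω) n) P := by
  have h1 := (h.hasGaussianLaw_sampleMean_sub n).indepFun_of_covariance_eval fun _ j => by
    rw [covariance_fun_sub_right (h.hasGaussianLaw_sampleMean n).memLp_two (h.memLp_two j)
      (h.hasGaussianLaw_sampleMean n).memLp_two, h.covariance_sampleMean j.2,
      covariance_self (h.aemeasurable_sampleMean n), h.variance_sampleMean (by have := j.2; omega),
      sub_self]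
  have h2 := h1.comp (φ := fun v => √(n : ℝ) * v ())
    (ψ := fun v => (∑ j : Fin n, v j ^ 2) / ((n : ℝ) - 1)) (by fun_prop) (by fun_prop)
  convert! h2 using 1
  ext ω
  simp [sampleVar, Finset.sum_range]

end IsStdNormalSample

/-! ### Moments of the sample variance. -/

lemma integral_sq_gaussianReal : ∫ z, z ^ 2 ∂(gaussianReal 0 1) = 1 := by
  have h := variance_fun_id_gaussianReal (μ := 0) (v := 1)
  rw [variance_eq_integral (by fun_prop)] at h
  simpa using h

/-- Dropping the squared mean and using `n/(n-1) ≤ 2` leaves twice the average of the squares;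
convexity of the fourth power does the rest. -/
lemma sampleVar_pow_four_le (x : ℕ → ℝ) {n : ℕ} (hn : 2 ≤ n) :
    sampleVar x n ^ 4 ≤ 16 * ((n : ℝ)⁻¹ * ∑ i ∈ Finset.range n, x i ^ 8) := by
  have hn2 : (2 : ℝ) ≤ n := by exact_mod_cast hn
  have hn0 : (0 : ℝ) < n := by linarith
  have h1 : sampleVar x n ≤ 2 * ∑ i ∈ Finset.range n, (n : ℝ)⁻¹ * x i ^ 2 := by
    rw [sampleVar_eq x hn, ← Finset.mul_sum, div_le_iff₀ (by linarith)]
    have hS : 0 ≤ ∑ i ∈ Finset.range n, x i ^ 2 := Finset.sum_nonneg fun i _ => sq_nonneg _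
    set S := ∑ i ∈ Finset.range n, x i ^ 2
    have e : 2 * ((n : ℝ)⁻¹ * S) * (n - 1) = S + S * ((n - 2) / n) := by field_simp; ring
    have : 0 ≤ S * ((n - 2) / n) := mul_nonneg hS (div_nonneg (by linarith) hn0.le)
    rw [e]
    nlinarith [sq_nonneg (stdMean x n)]
  have h2 := Real.pow_arith_mean_le_arith_mean_pow (Finset.range n) (fun _ => (n : ℝ)⁻¹)
    (fun i => x i ^ 2) (fun _ _ => by positivity) (by simp [hn0.ne']) (fun _ _ => by positivity) 4
  calc sampleVar x n ^ 4 ≤ (2 * ∑ i ∈ Finset.range n, (n : ℝ)⁻¹ * x i ^ 2) ^ 4 := by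
        gcongr; exact sampleVar_nonneg x hn
    _ = 16 * (∑ i ∈ Finset.range n, (n : ℝ)⁻¹ * x i ^ 2) ^ 4 := by ring
    _ ≤ 16 * ∑ i ∈ Finset.range n, (n : ℝ)⁻¹ * (x i ^ 2) ^ 4 := by gcongr
    _ = _ := by simp_rw [← pow_mul, Finset.mul_sum]

namespace IsStdNormalSample

variable {Ω : Type*} [MeasurableSpace Ω] {P : Measure Ω} {Y : ℕ → Ω → ℝ}

lemma variance_sq (h : IsStdNormalSample Y P) (i : ℕ) :
    Var[fun ω => Y i ω ^ 2; P] = ∫ z, (z ^ 2 - 1) ^ 2 ∂(gaussianReal 0 1) := by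
  rw [variance_eq_integral ((h.aemeasurable i).pow_const 2), h.integral_pow,
    integral_sq_gaussianReal]
  exact (h.law i).integral_comp (f := fun z : ℝ => (z ^ 2 - 1) ^ 2) (by fun_prop)

lemma memLp_sq (h : IsStdNormalSample Y P) (i : ℕ) : MemLp (fun ω => Y i ω ^ 2) 2 P := by
  rw [memLp_two_iff_integrable_sq ((h.aemeasurable i).pow_const 2).aestronglyMeasurable]
  refine (h.integrable_pow i 4).congr (ae_of_all _ fun ω => ?_)
  ring

lemma aemeasurable_stdMean (h : IsStdNormalSample Y P) (n : ℕ) :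
    AEMeasurable (fun ω => stdMean (fun i => Y i ω) n) P :=
  (h.aemeasurable_sampleMean n).const_mul _

lemma integrable_sampleVar_pow_four (h : IsStdNormalSample Y P) {n : ℕ} (hn : 2 ≤ n) :
    Integrable (fun ω => sampleVar (fun i => Y i ω) n ^ 4) P := by
  refine Integrable.mono' (((integrable_finsetSum (Finset.range n) fun i _ =>
    h.integrable_pow i 8).const_mul ((n : ℝ)⁻¹)).const_mul 16)
    ((h.aemeasurable_sampleVar n).pow_const 4).aestronglyMeasurable (ae_of_all _ fun ω => ?_)
  rw [Real.norm_of_nonneg (by positivity)]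
  exact sampleVar_pow_four_le _ hn

lemma integral_sampleVar_pow_four_le (h : IsStdNormalSample Y P) {n : ℕ} (hn : 2 ≤ n) :
    ∫ ω, sampleVar (fun i => Y i ω) n ^ 4 ∂P ≤ 16 * ∫ z, z ^ 8 ∂(gaussianReal 0 1) := by
  have hn0 : (n : ℝ) ≠ 0 := by positivity
  have hi := integrable_finsetSum (Finset.range n) fun i _ => h.integrable_pow i 8
  refine (integral_mono (h.integrable_sampleVar_pow_four hn)
    ((hi.const_mul ((n : ℝ)⁻¹)).const_mul 16) fun ω => sampleVar_pow_four_le _ hn).trans_eq ?_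
  rw [integral_const_mul, integral_const_mul,
    integral_finsetSum _ fun i _ => h.integrable_pow i 8]
  simp_rw [h.integral_pow]
  simp [hn0]

variable [IsProbabilityMeasure P]

lemma integrable_stdMean_pow (h : IsStdNormalSample Y P) {n : ℕ} (hn : 0 < n) (k : ℕ) :
    Integrable (fun ω => stdMean (fun i => Y i ω) n ^ k) P := by
  have := (integrable_pow_gaussianReal k)
  rw [← (h.hasLaw_stdMean hn).map_eq] at this
  exact this.comp_aemeasurable (h.aemeasurable_stdMean n)

lemma integral_stdMean_pow (h : IsStdNormalSample Y P) {n : ℕ} (hn : 0 < n) (k : ℕ) :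
    ∫ ω, stdMean (fun i => Y i ω) n ^ k ∂P = ∫ z, z ^ k ∂(gaussianReal 0 1) :=
  (h.hasLaw_stdMean hn).integral_comp (f := fun z : ℝ => z ^ k) (by fun_prop)

lemma integrable_sampleVar_pow (h : IsStdNormalSample Y P) {n : ℕ} (hn : 2 ≤ n) {k : ℕ}
    (hk : k ≤ 4) : Integrable (fun ω => sampleVar (fun i => Y i ω) n ^ k) P := by
  refine Integrable.mono' ((integrable_const 1).add (h.integrable_sampleVar_pow_four hn))
    ((h.aemeasurable_sampleVar n).pow_const k).aestronglyMeasurable (ae_of_all _ fun ω => ?_)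
  have h0 := sampleVar_nonneg (fun i => Y i ω) hn
  rw [Real.norm_of_nonneg (by positivity)]
  simp only [Pi.add_apply]
  rcases le_total (sampleVar (fun i => Y i ω) n) 1 with h1 | h1
  · have := pow_le_one₀ h0 h1 (n := k)
    have : 0 ≤ sampleVar (fun i => Y i ω) n ^ 4 := by positivity
    linarith
  · have := pow_le_pow_right₀ h1 hk
    linarith

lemma integral_sampleVar (h : IsStdNormalSample Y P) {n : ℕ} (hn : 2 ≤ n) :
    ∫ ω, sampleVar (fun i => Y i ω) n ∂P = 1 := by
  have hn2 : (2 : ℝ) ≤ n := by exact_mod_cast hn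
  simp_rw [sampleVar_eq _ hn]
  rw [integral_div, integral_sub (integrable_finsetSum _ fun i _ => h.integrable_pow i 2)
    (h.integrable_stdMean_pow (by omega) 2),
    integral_finsetSum _ fun i _ => h.integrable_pow i 2]
  simp_rw [h.integral_stdMean_pow (n := n) (by omega), h.integral_pow, integral_sq_gaussianReal]
  simp only [Finset.sum_const, Finset.card_range, nsmul_eq_mul, mul_one]
  exact div_self (by linarith)

lemma integral_sum_sq_sub_sq (h : IsStdNormalSample Y P) (n : ℕ) :
    ∫ ω, (∑ i ∈ Finset.range n, Y i ω ^ 2 - n) ^ 2 ∂P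
      = n * ∫ z, (z ^ 2 - 1) ^ 2 ∂(gaussianReal 0 1) := by
  have e : ∫ ω, ∑ i ∈ Finset.range n, Y i ω ^ 2 ∂P = n := by
    rw [integral_finsetSum _ fun i _ => h.integrable_pow i 2]
    simp [h.integral_pow, integral_sq_gaussianReal]
  have hm := h.aemeasurable
  have hv := variance_eq_integral (μ := P) (X := fun ω => ∑ i ∈ Finset.range n, Y i ω ^ 2)
    (by fun_prop)
  rw [e] at hv
  rw [← hv, variance_fun_sum' (fun i _ => h.memLp_sq i)]
  have hind : ∀ i j, cov[fun ω => Y i ω ^ 2, fun ω => Y j ω ^ 2; P]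
      = if i = j then ∫ z, (z ^ 2 - 1) ^ 2 ∂(gaussianReal 0 1) else 0 := by
    intro i j
    split_ifs with hij
    · subst hij
      rw [covariance_self ((h.aemeasurable i).pow_const 2), h.variance_sq]
    · exact ((h.indep.indepFun hij).comp (φ := fun x : ℝ => x ^ 2) (ψ := fun x : ℝ => x ^ 2)
        (by fun_prop) (by fun_prop)).covariance_eq_zero (h.memLp_sq i) (h.memLp_sq j)
  simp_rw [hind]
  rw [Finset.sum_congr rfl fun i hi => by rw [Finset.sum_ite_eq, if_pos hi]]
  simp

/-- `(n-1)(W-1)` is the centred sum of squares minus `Z² - 1`; their second moments are `nv` and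
`v`. -/
lemma integral_sampleVar_sub_one_sq_le (h : IsStdNormalSample Y P) {n : ℕ} (hn : 2 ≤ n) :
    ∫ ω, (sampleVar (fun i => Y i ω) n - 1) ^ 2 ∂P
      ≤ 12 * (∫ z : ℝ, (z ^ 2 - 1) ^ 2 ∂(gaussianReal 0 1)) / (n : ℝ) := by
  have hn2 : (2 : ℝ) ≤ n := by exact_mod_cast hn
  have hn1 : (0 : ℝ) < n - 1 := by linarith
  set v := ∫ z : ℝ, (z ^ 2 - 1) ^ 2 ∂(gaussianReal 0 1)
  have hv : 0 ≤ v := integral_nonneg fun z => sq_nonneg _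
  have hm := h.aemeasurable
  have iA : Integrable (fun ω => (∑ i ∈ Finset.range n, Y i ω ^ 2 - n) ^ 2) P :=
    ((memLp_finsetSum (Finset.range n) fun i _ => h.memLp_sq i).sub
      (memLp_const (n : ℝ))).integrable_sq
  have iB : Integrable (fun ω => (stdMean (fun i => Y i ω) n ^ 2 - 1) ^ 2) P := by
    have := ((h.integrable_stdMean_pow (n := n) (by omega) 4).sub
      ((h.integrable_stdMean_pow (n := n) (by omega) 2).const_mul 2)).add (integrable_const (1 : ℝ))
    refine this.congr (ae_of_all _ fun ω => ?_)
    simp; ring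
  have eB : ∫ ω, (stdMean (fun i => Y i ω) n ^ 2 - 1) ^ 2 ∂P = v :=
    (h.hasLaw_stdMean (by omega)).integral_comp (f := fun z : ℝ => (z ^ 2 - 1) ^ 2) (by fun_prop)
  have hle : ∀ ω, (sampleVar (fun i => Y i ω) n - 1) ^ 2
      ≤ 2 / ((n : ℝ) - 1) ^ 2 * ((∑ i ∈ Finset.range n, Y i ω ^ 2 - n) ^ 2
        + (stdMean (fun i => Y i ω) n ^ 2 - 1) ^ 2) := fun ω => by
    rw [sampleVar_eq _ hn]
    set A := ∑ i ∈ Finset.range n, Y i ω ^ 2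
    set B := stdMean (fun i => Y i ω) n ^ 2
    have e : (A - B) / ((n : ℝ) - 1) - 1 = ((A - n) - (B - 1)) / (n - 1) := by
      field_simp; ring
    rw [e, div_pow, div_mul_eq_mul_div]
    gcongr
    nlinarith [sq_nonneg ((A - n) + (B - 1))]
  calc _ ≤ ∫ ω, 2 / ((n : ℝ) - 1) ^ 2 * ((∑ i ∈ Finset.range n, Y i ω ^ 2 - n) ^ 2
        + (stdMean (fun i => Y i ω) n ^ 2 - 1) ^ 2) ∂P :=
        integral_mono_of_nonneg (ae_of_all _ fun ω => sq_nonneg _) ((iA.add iB).const_mul _)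
          (ae_of_all _ hle)
    _ = 2 / ((n : ℝ) - 1) ^ 2 * (n * v + v) := by
        rw [integral_const_mul, integral_add iA iB, eB, h.integral_sum_sq_sub_sq]
    _ ≤ _ := by
        rw [div_mul_eq_mul_div, div_le_div_iff₀ (by positivity) (by positivity)]
        -- Equality holds at `n = 2`, which fixes the constant 12.
        have : 2 * ((n : ℝ) + 1) * n ≤ 12 * (n - 1) ^ 2 := by nlinarith
        nlinarith

end IsStdNormalSample

/-! ### Deviation probabilities, averaged over the sample variance. -/

/-- The probability that `|Z + b(Z² - dW)| ≥ u`, for the standardized mean `Z` and the sample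
variance `W` of the first `n` observations. -/
noncomputable def devProb {Ω : Type*} [MeasurableSpace Ω] (P : Measure Ω) (Y : ℕ → Ω → ℝ)
    (d b u : ℝ) (n : ℕ) : ℝ :=
  P.real {ω | u ≤ |stdMean (fun i => Y i ω) n
    + b * (stdMean (fun i => Y i ω) n ^ 2 - d * sampleVar (fun i => Y i ω) n)|}

lemma measurable_quadTail (b u d : ℝ) : Measurable fun w => quadTail b u (d * w) := by
  have hS : MeasurableSet {p : ℝ × ℝ | u ≤ |p.1 + b * (p.1 ^ 2 - d * p.2)|} :=
    measurableSet_le (by fun_prop) (by fun_prop)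
  exact (measurable_measure_prodMk_right (μ := gaussianReal 0 1) hS).ennreal_toReal

namespace IsStdNormalSample

variable {Ω : Type*} [MeasurableSpace Ω] {P : Measure Ω} {Y : ℕ → Ω → ℝ}
  [IsProbabilityMeasure P]

lemma integrable_quadTail (h : IsStdNormalSample Y P) (d b u : ℝ) (n : ℕ) :
    Integrable (fun ω => quadTail b u (d * sampleVar (fun i => Y i ω) n)) P := by
  refine Integrable.mono' (integrable_const 1) ((measurable_quadTail b u d).comp_aemeasurable
    (h.aemeasurable_sampleVar n)).aestronglyMeasurable (ae_of_all _ fun ω => ?_)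
  rw [Real.norm_of_nonneg (quadTail_nonneg _ _ _)]
  exact quadTail_le_one _ _ _

/-- Fubini for the product law of `(Z, W)`. -/
lemma devProb_eq (h : IsStdNormalSample Y P) {n : ℕ} (hn : 0 < n) (d b u : ℝ) :
    devProb P Y d b u n = ∫ ω, quadTail b u (d * sampleVar (fun i => Y i ω) n) ∂P := by
  have hZ := h.aemeasurable_stdMean n
  have hW := h.aemeasurable_sampleVar n
  have hS : MeasurableSet {p : ℝ × ℝ | u ≤ |p.1 + b * (p.1 ^ 2 - d * p.2)|} :=
    measurableSet_le (by fun_prop) (by fun_prop)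
  have hlaw := (indepFun_iff_map_prod_eq_prod_map_map hZ hW).1 (h.indepFun_stdMean_sampleVar n)
  rw [(h.hasLaw_stdMean hn).map_eq] at hlaw
  have h1 : devProb P Y d b u n = (P.map fun ω => (stdMean (fun i => Y i ω) n,
      sampleVar (fun i => Y i ω) n)).real {p : ℝ × ℝ | u ≤ |p.1 + b * (p.1 ^ 2 - d * p.2)|} := by
    rw [map_measureReal_apply_of_aemeasurable (hZ.prodMk hW) hS]
    rfl
  have : IsProbabilityMeasure (P.map fun ω => sampleVar (fun i => Y i ω) n) :=
    Measure.isProbabilityMeasure_map hW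
  rw [h1, hlaw, measureReal_def, Measure.prod_apply_symm hS,
    ← integral_toReal (measurable_measure_prodMk_right hS).aemeasurable
      (ae_of_all _ fun w => measure_lt_top _ _)]
  exact integral_map hW (measurable_quadTail b u d).aestronglyMeasurable

lemma devProb_zero (h : IsStdNormalSample Y P) {n : ℕ} (hn : 0 < n) (b u : ℝ) :
    devProb P Y 0 b u n = quadTail b u 0 := by
  rw [h.devProb_eq hn]; simp

lemma integral_sampleVar_sq (h : IsStdNormalSample Y P) {n : ℕ} (hn : 2 ≤ n) :
    ∫ ω, sampleVar (fun i => Y i ω) n ^ 2 ∂P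
      = 1 + ∫ ω, (sampleVar (fun i => Y i ω) n - 1) ^ 2 ∂P := by
  have i2 := h.integrable_sampleVar_pow hn (k := 2) (by norm_num)
  have i1 := h.integrable_sampleVar_pow hn (k := 1) (by norm_num)
  have i2' : Integrable (fun ω => 2 * sampleVar (fun i => Y i ω) n) P := by
    simpa using i1.const_mul 2
  have i3 : Integrable (fun ω => sampleVar (fun i => Y i ω) n ^ 2
      - 2 * sampleVar (fun i => Y i ω) n) P := i2.sub i2'
  simp_rw [sub_sq, mul_one, one_pow]
  rw [integral_add i3 (integrable_const _), integral_sub i2 i2', integral_const_mul,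
    h.integral_sampleVar hn]
  simp
  ring

/-- The second order effect of the constant `d` on the deviation probability. -/
lemma exists_abs_devProb_sub_le (h : IsStdNormalSample Y P) (d : ℝ) :
    ∃ C, 0 ≤ C ∧ ∀ (n : ℕ) (b u : ℝ), 2 ≤ n → 0 < b → 0 < u →
      |devProb P Y d b u n - devProb P Y 0 b u n
        - b ^ 2 * (gaussDens u * (d ^ 2 + 4 * d - 2 * d * u ^ 2) * u)|
        ≤ C * (b ^ 3 + b ^ 2 / n) := by
  obtain ⟨C, hC, hT⟩ := exists_abs_quadTail_sub_le
  set M := 16 * ∫ z : ℝ, z ^ 8 ∂(gaussianReal 0 1)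
  set v := ∫ z : ℝ, (z ^ 2 - 1) ^ 2 ∂(gaussianReal 0 1)
  have hM : 0 ≤ M := mul_nonneg (by norm_num) (integral_nonneg fun z => by positivity)
  have hv : 0 ≤ v := integral_nonneg fun z => by positivity
  refine ⟨C * (8 * (1 + d ^ 4 * M)) + 768 * d ^ 2 * (12 * v), by positivity,
    fun n b u hn hb hu => ?_⟩
  have hg := gaussDens_pos u
  have i1 : Integrable (fun ω => sampleVar (fun i => Y i ω) n) P := by
    simpa using h.integrable_sampleVar_pow hn (k := 1) (by norm_num)
  have i2 := h.integrable_sampleVar_pow hn (k := 2) (by norm_num)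
  have i4 := h.integrable_sampleVar_pow_four hn
  have iH := h.integrable_quadTail d b u n
  set W : Ω → ℝ := fun ω => sampleVar (fun i => Y i ω) n
  have hW : ∀ ω, 0 ≤ W ω := fun ω => sampleVar_nonneg _ hn
  have hpt : ∀ ω, ‖quadTail b u (d * W ω) - quadTail b u 0
      - b ^ 2 * (gaussDens u * u * (d ^ 2 * W ω ^ 2 + (4 * d - 2 * d * u ^ 2) * W ω))‖
      ≤ C * b ^ 3 * (8 * (1 + d ^ 4 * W ω ^ 4)) := fun ω => by
    have h1 := hT b u (d * W ω) hb hu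
    have h2 : (1 + |d * W ω|) ^ 3 ≤ 8 * (1 + d ^ 4 * W ω ^ 4) := by
      rw [← mul_pow, ← Even.pow_abs (by decide : Even 4) (d * W ω)]
      have hx := abs_nonneg (d * W ω)
      set x := |d * W ω|
      calc (1 + x) ^ 3 ≤ (1 + x) ^ 4 := pow_le_pow_right₀ (by linarith) (by norm_num)
        _ ≤ 2 ^ 3 * (1 ^ 4 + x ^ 4) := add_pow_le (by norm_num) hx 4
        _ = _ := by norm_num
    rw [Real.norm_eq_abs]
    calc _ = |quadTail b u (d * W ω) - quadTail b u 0 - b ^ 2 * (gaussDens u * u *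
          ((d * W ω) ^ 2 + 4 * (d * W ω) - 2 * u ^ 2 * (d * W ω)))| := by congr 2; ring
      _ ≤ C * (b ^ 3 * (1 + |d * W ω|) ^ 3) := h1
      _ ≤ C * (b ^ 3 * (8 * (1 + d ^ 4 * W ω ^ 4))) := by gcongr
      _ = _ := by ring
  have iP : Integrable (fun ω => b ^ 2 * (gaussDens u * u *
      (d ^ 2 * W ω ^ 2 + (4 * d - 2 * d * u ^ 2) * W ω))) P :=
    (((i2.const_mul _).add (i1.const_mul _)).const_mul _).const_mul _
  -- `E W = 1` makes the linear term exact; `E W² = 1 + E(W-1)²` is the source of the `b²/n` in the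
  -- error.
  have eP : ∫ ω, (quadTail b u (d * W ω) - quadTail b u 0
      - b ^ 2 * (gaussDens u * u * (d ^ 2 * W ω ^ 2 + (4 * d - 2 * d * u ^ 2) * W ω))) ∂P
      = devProb P Y d b u n - devProb P Y 0 b u n
        - b ^ 2 * (gaussDens u * u * (d ^ 2 * (1 + ∫ ω, (W ω - 1) ^ 2 ∂P)
          + (4 * d - 2 * d * u ^ 2))) := by
    have iH' : Integrable (fun ω => quadTail b u (d * W ω) - quadTail b u 0) P :=
      iH.sub (integrable_const _)
    rw [integral_sub iH' iP, integral_sub iH (integrable_const _),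
      h.devProb_zero (by omega), h.devProb_eq (by omega), integral_const_mul, integral_const_mul,
      integral_add (i2.const_mul _) (i1.const_mul _), integral_const_mul, integral_const_mul,
      h.integral_sampleVar hn, h.integral_sampleVar_sq hn, integral_const, probReal_univ, one_smul,
      mul_one]
  have bound : |devProb P Y d b u n - devProb P Y 0 b u n
        - b ^ 2 * (gaussDens u * u * (d ^ 2 * (1 + ∫ ω, (W ω - 1) ^ 2 ∂P)
          + (4 * d - 2 * d * u ^ 2)))| ≤ C * b ^ 3 * (8 * (1 + d ^ 4 * M)) := by
    rw [← eP, ← Real.norm_eq_abs]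
    have iB : Integrable (fun ω => C * b ^ 3 * (8 * (1 + d ^ 4 * W ω ^ 4))) P :=
      (((integrable_const 1).add (i4.const_mul (d ^ 4))).const_mul 8).const_mul (C * b ^ 3)
    refine (norm_integral_le_of_norm_le iB (ae_of_all _ hpt)).trans ?_
    rw [integral_const_mul, integral_const_mul, integral_add (integrable_const _)
      (i4.const_mul _), integral_const_mul]
    simp only [integral_const, probReal_univ, one_smul]
    gcongr
    exact h.integral_sampleVar_pow_four_le hn
  have hV0 : 0 ≤ ∫ ω, (W ω - 1) ^ 2 ∂P := integral_nonneg fun ω => sq_nonneg _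
  have hV := h.integral_sampleVar_sub_one_sq_le hn
  set V := ∫ ω, (W ω - 1) ^ 2 ∂P
  have hgu : gaussDens u * u ≤ 768 := by
    simpa [abs_of_pos hu] using gaussDens_mul_pow_le u (k := 1) (by norm_num)
  have hextra : b ^ 2 * (gaussDens u * u * (d ^ 2 * V))
      ≤ 768 * d ^ 2 * (12 * v) * (b ^ 2 / n) := by
    calc b ^ 2 * (gaussDens u * u * (d ^ 2 * V)) ≤ b ^ 2 * (768 * (d ^ 2 * (12 * v / n))) := by
          gcongr
      _ = _ := by ring
  have hextra0 : 0 ≤ b ^ 2 * (gaussDens u * u * (d ^ 2 * V)) := by positivity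
  have hb3 : 0 ≤ C * (8 * (1 + d ^ 4 * M)) * (b ^ 2 / n) := by positivity
  have hbn : 0 ≤ 768 * d ^ 2 * (12 * v) * b ^ 3 := by positivity
  rw [abs_le] at bound ⊢
  constructor <;> nlinarith [bound.1, bound.2]

/-- At `b = τ/(2√n)` one has `b² = (τ²/2)/(2n)`, so the second-order effect matches the derivative
of `(τ²/2) M(κ√x)`. The error is summable in `n` and uniform in `κ`. -/
lemma exists_abs_devProb_sub_gainPrim_le (h : IsStdNormalSample Y P) (d : ℝ) {τ : ℝ}
    (hτ : 0 < τ) :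
    ∃ C, 0 ≤ C ∧ ∀ (n : ℕ) (κ : ℝ), 2 ≤ n → 0 < κ →
      |devProb P Y d (τ / (2 * √(n : ℝ))) (κ * √(n : ℝ)) n
        - devProb P Y 0 (τ / (2 * √(n : ℝ))) (κ * √(n : ℝ)) n
        - τ ^ 2 / 2 * (gainPrim d (κ * √((n : ℝ) + 1)) - gainPrim d (κ * √(n : ℝ)))|
        ≤ C * (1 / (n * √(n : ℝ))) := by
  obtain ⟨C, hC, hT⟩ := h.exists_abs_devProb_sub_le d
  obtain ⟨D, hD, hF⟩ := exists_abs_gainPrim_sub_le d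
  refine ⟨C * (τ ^ 3 / 8 + τ ^ 2 / 4) + τ ^ 2 / 2 * D, by positivity, fun n κ hn hκ => ?_⟩
  have hn2 : (2 : ℝ) ≤ n := by exact_mod_cast hn
  have hn0 : (0 : ℝ) < n := by linarith
  set r := √(n : ℝ) with hr
  have hr2 : r ^ 2 = n := Real.sq_sqrt hn0.le
  have hr1 : 1 ≤ r := by rw [hr, Real.one_le_sqrt]; linarith
  have hr0 : 0 < r := by linarith
  have h1 := hT n (τ / (2 * r)) (κ * r) hn (by positivity) (by positivity)
  have h2 := hF κ n hκ hn0
  rw [← hr] at h2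
  have e1 : (τ / (2 * r)) ^ 2 = τ ^ 2 / 2 / (2 * n) := by rw [← hr2]; field_simp
  have e2 : (τ / (2 * r)) ^ 3 = τ ^ 3 / 8 * (1 / (n * r)) := by
    rw [← hr2]; field_simp; norm_num
  have e4 : 1 / (n : ℝ) ^ 2 ≤ 1 / (n * r) := by
    apply one_div_le_one_div_of_le (by positivity)
    rw [← hr2]
    nlinarith [pow_pos hr0 3]
  have e3 : (τ / (2 * r)) ^ 2 / n ≤ τ ^ 2 / 4 * (1 / (n * r)) := by
    calc (τ / (2 * r)) ^ 2 / n = τ ^ 2 / 4 * (1 / (n : ℝ) ^ 2) := by rw [e1]; field_simp; norm_num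
      _ ≤ _ := by gcongr
  set G := gainPrim d (κ * √((n : ℝ) + 1)) - gainPrim d (κ * r)
  set m := gaussDens (κ * r) * (d ^ 2 + 4 * d - 2 * d * (κ * r) ^ 2) * (κ * r)
  have h3 : |τ ^ 2 / 2 * (G - m / (2 * n))| ≤ τ ^ 2 / 2 * D * (1 / (n * r)) := by
    rw [abs_mul, abs_of_pos (by positivity)]
    calc _ ≤ τ ^ 2 / 2 * (D / (n : ℝ) ^ 2) := by gcongr
      _ = τ ^ 2 / 2 * D * (1 / (n : ℝ) ^ 2) := by ring
      _ ≤ _ := by gcongr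
  have h4 : C * ((τ / (2 * r)) ^ 3 + (τ / (2 * r)) ^ 2 / n)
      ≤ C * (τ ^ 3 / 8 + τ ^ 2 / 4) * (1 / (n * r)) := by
    rw [e2, mul_assoc, add_mul]
    gcongr
  have h5 := h1.trans h4
  rw [e1] at h5
  rw [abs_le] at h3 h5 ⊢
  have e5 : τ ^ 2 / 2 / (2 * n) * m = τ ^ 2 / 2 * (m / (2 * n)) := by ring
  rw [e5] at h5
  constructor <;> nlinarith [h3.1, h3.2, h5.1, h5.2]

/-- Fourth-moment Markov bound. Its constant depends on `κ`, so it serves only for summability at a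
fixed `ε`. -/
lemma exists_devProb_le (h : IsStdNormalSample Y P) (d : ℝ) {τ κ : ℝ} (hτ : 0 < τ) (hκ : 0 < κ) :
    ∃ C, ∀ n : ℕ, 2 ≤ n →
      devProb P Y d (τ / (2 * √(n : ℝ))) (κ * √(n : ℝ)) n ≤ C * (1 / (n : ℝ) ^ 2) := by
  set m4 := ∫ z : ℝ, z ^ 4 ∂(gaussianReal 0 1)
  set m8 := ∫ z : ℝ, z ^ 8 ∂(gaussianReal 0 1)
  refine ⟨27 * (m4 + τ ^ 4 * m8 + τ ^ 4 * (d ^ 4 * (16 * m8))) / κ ^ 4, fun n hn => ?_⟩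
  have hn2 : (2 : ℝ) ≤ n := by exact_mod_cast hn
  have hn0 : (0 : ℝ) < n := by linarith
  set r := √(n : ℝ) with hr
  have hr2 : r ^ 2 = n := Real.sq_sqrt hn0.le
  have hr1 : 1 ≤ r := by rw [hr, Real.one_le_sqrt]; linarith
  have hr0 : 0 < r := by linarith
  have iZ4 := h.integrable_stdMean_pow (n := n) (by omega) 4
  have iZ8 := h.integrable_stdMean_pow (n := n) (by omega) 8
  have iW := h.integrable_sampleVar_pow_four hn
  have eZ4 := h.integral_stdMean_pow (n := n) (by omega) 4
  have eZ8 := h.integral_stdMean_pow (n := n) (by omega) 8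
  have eW := h.integral_sampleVar_pow_four_le hn
  unfold devProb
  set Z : Ω → ℝ := fun ω => stdMean (fun i => Y i ω) n
  set W : Ω → ℝ := fun ω => sampleVar (fun i => Y i ω) n
  set b := τ / (2 * r)
  have hb0 : 0 < b := by positivity
  have hb : b ≤ τ := by
    apply div_le_self hτ.le; linarith
  have hpt : ∀ ω, (Z ω + b * (Z ω ^ 2 - d * W ω)) ^ 4
      ≤ 27 * (Z ω ^ 4 + τ ^ 4 * Z ω ^ 8 + τ ^ 4 * (d ^ 4 * W ω ^ 4)) := fun ω => by
    have hb4 : b ^ 4 ≤ τ ^ 4 := by gcongr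
    -- Cauchy–Schwarz twice: `27 = 3² * 3`.
    have key : ∀ x y z : ℝ, (x + y - z) ^ 4 ≤ 27 * (x ^ 4 + y ^ 4 + z ^ 4) := fun x y z => by
      have h1 : (x + y - z) ^ 2 ≤ 3 * (x ^ 2 + y ^ 2 + z ^ 2) := by
        nlinarith [sq_nonneg (x - y), sq_nonneg (x + z), sq_nonneg (y + z)]
      have h2 : (x ^ 2 + y ^ 2 + z ^ 2) ^ 2 ≤ 3 * (x ^ 4 + y ^ 4 + z ^ 4) := by
        nlinarith [sq_nonneg (x ^ 2 - y ^ 2), sq_nonneg (x ^ 2 - z ^ 2), sq_nonneg (y ^ 2 - z ^ 2)]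
      calc (x + y - z) ^ 4 = ((x + y - z) ^ 2) ^ 2 := by ring
        _ ≤ (3 * (x ^ 2 + y ^ 2 + z ^ 2)) ^ 2 := by gcongr
        _ = 9 * (x ^ 2 + y ^ 2 + z ^ 2) ^ 2 := by ring
        _ ≤ _ := by linarith
    calc (Z ω + b * (Z ω ^ 2 - d * W ω)) ^ 4 = (Z ω + b * Z ω ^ 2 - b * (d * W ω)) ^ 4 := by ring
      _ ≤ 27 * (Z ω ^ 4 + (b * Z ω ^ 2) ^ 4 + (b * (d * W ω)) ^ 4) := key _ _ _
      _ = 27 * (Z ω ^ 4 + b ^ 4 * Z ω ^ 8 + b ^ 4 * (d ^ 4 * W ω ^ 4)) := by ring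
      _ ≤ _ := by gcongr
  have iZ : Integrable (fun ω => Z ω ^ 4 + τ ^ 4 * Z ω ^ 8) P := iZ4.add (iZ8.const_mul (τ ^ 4))
  have iB : Integrable (fun ω =>
      27 * (Z ω ^ 4 + τ ^ 4 * Z ω ^ 8 + τ ^ 4 * (d ^ 4 * W ω ^ 4))) P :=
    (iZ.add ((iW.const_mul (d ^ 4)).const_mul (τ ^ 4))).const_mul 27
  have hmk := mul_meas_ge_le_integral_of_nonneg (μ := P)
    (ae_of_all _ fun ω => by
      have : (0 : ℝ) ≤ (Z ω + b * (Z ω ^ 2 - d * W ω)) ^ 4 := by positivity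
      exact this.trans (hpt ω)) iB ((κ * r) ^ 4)
  rw [integral_const_mul, integral_add iZ ((iW.const_mul _).const_mul _),
    integral_add iZ4 (iZ8.const_mul _), integral_const_mul,
    integral_const_mul, integral_const_mul, eZ4, eZ8] at hmk
  have hsub : P.real {ω | κ * r ≤ |Z ω + b * (Z ω ^ 2 - d * W ω)|} ≤ P.real {ω | (κ * r) ^ 4
      ≤ 27 * (Z ω ^ 4 + τ ^ 4 * Z ω ^ 8 + τ ^ 4 * (d ^ 4 * W ω ^ 4))} := by
    refine measureReal_mono fun ω (hω : κ * r ≤ _) => ?_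
    have h4 : (κ * r) ^ 4 ≤ |Z ω + b * (Z ω ^ 2 - d * W ω)| ^ 4 := by gcongr
    rw [Even.pow_abs (by decide)] at h4
    exact h4.trans (hpt ω)
  have hr4 : (κ * r) ^ 4 = κ ^ 4 * (n : ℝ) ^ 2 := by rw [← hr2]; ring
  rw [div_mul_div_comm, mul_one, le_div_iff₀ (by positivity), ← hr4, mul_comm]
  calc _ ≤ _ := mul_le_mul_of_nonneg_left hsub (by positivity)
    _ ≤ _ := hmk
    _ ≤ _ := by gcongr

end IsStdNormalSample

/-! ### From events to expected counts. -/

/-- The number of events of a sequence that occur is almost surely finite and integrable when the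
probabilities are summable, and its expectation is their sum. -/
lemma ncard_events_of_summable {Ω : Type*} [MeasurableSpace Ω] {P : Measure Ω} [IsFiniteMeasure P]
    {S : ℕ → Set Ω} (hS : ∀ n, NullMeasurableSet (S n) P)
    (hsum : Summable fun n => P.real (S n)) :
    (∀ᵐ ω ∂P, {n | ω ∈ S n}.Finite) ∧
      Integrable (fun ω => ({n | ω ∈ S n}.ncard : ℝ)) P ∧
      ∫ ω, ({n | ω ∈ S n}.ncard : ℝ) ∂P = ∑' n, P.real (S n) := by
  have hne : ∑' n, P (S n) ≠ ⊤ := by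
    have e : ∀ n, P (S n) = ENNReal.ofReal (P.real (S n)) := fun n =>
      (ofReal_measureReal).symm
    simp_rw [e]
    exact hsum.tsum_ofReal_ne_top
  -- Borel–Cantelli; the expectation below is Tonelli applied to the sum of indicators.
  have hfin : ∀ᵐ ω ∂P, {n | ω ∈ S n}.Finite := ae_finite_setOfPred_mem hne
  set f : Ω → ENNReal := fun ω => ∑' n, (S n).indicator (fun _ => 1) ω
  have hm : ∀ n, AEMeasurable ((S n).indicator fun _ => (1 : ENNReal)) P := fun n =>
    (aemeasurable_const (b := (1 : ENNReal))).indicator₀ (hS n)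
  have hf : AEMeasurable f P := AEMeasurable.tsum hm
  have hlint : ∫⁻ ω, f ω ∂P = ∑' n, P (S n) := by
    rw [lintegral_tsum hm]
    simp_rw [lintegral_indicator_const₀ (hS _), one_mul]
  have hae : ∀ᵐ ω ∂P, (f ω).toReal = ({n | ω ∈ S n}.ncard : ℝ) := by
    filter_upwards [hfin] with ω hω
    have h1 : f ω = ∑ n ∈ hω.toFinset, (S n).indicator (fun _ => 1) ω :=
      tsum_eq_sum fun n hn => Set.indicator_of_notMem (by simpa using hn) _
    have h2 : ∑ n ∈ hω.toFinset, (S n).indicator (fun _ => (1 : ENNReal)) ω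
        = ∑ n ∈ hω.toFinset, 1 := Finset.sum_congr rfl fun n hn =>
      Set.indicator_of_mem (by simpa using hn) _
    rw [h1, h2, Set.ncard_eq_toFinset_card _ hω]
    simp
  refine ⟨hfin, ?_, ?_⟩
  · exact (integrable_toReal_of_lintegral_ne_top hf (by rwa [hlint])).congr hae
  · rw [← integral_congr_ae hae, integral_toReal hf (ae_lt_top' hf (by rwa [hlint])), hlint,
      ENNReal.tsum_toReal_eq fun n => measure_ne_top _ _]
    rfl

lemma sampleMean_affine (y : ℕ → ℝ) (ξ c : ℝ) {n : ℕ} (hn : 0 < n) :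
    sampleMean (fun i => ξ + c * y i) n = ξ + c * sampleMean y n := by
  have : (n : ℝ) ≠ 0 := by positivity
  simp only [sampleMean, Finset.sum_add_distrib, Finset.sum_const, Finset.card_range,
    nsmul_eq_mul, ← Finset.mul_sum]
  field_simp

lemma sampleVar_affine (y : ℕ → ℝ) (ξ c : ℝ) {n : ℕ} (hn : 0 < n) :
    sampleVar (fun i => ξ + c * y i) n = c ^ 2 * sampleVar y n := by
  unfold sampleVar
  rw [sampleMean_affine y ξ c hn, ← mul_div_assoc, Finset.mul_sum]
  congr 1
  exact Finset.sum_congr rfl fun i _ => by ring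

/-- Scaling by `τξ` rather than `σ` makes the common factor `2τξ²/√n` positive for either sign of
`ξ`. -/
lemma le_abs_sqMeanEstimator_sub_iff (y : ℕ → ℝ) {ξ τ : ℝ} (hξ : ξ ≠ 0) (hτ : 0 < τ) (d ε : ℝ)
    {n : ℕ} (hn : 0 < n) :
    ε ≤ |sqMeanEstimator d (fun i => ξ + τ * ξ * y i) n - ξ ^ 2| ↔
      ε / (2 * τ * ξ ^ 2) * √(n : ℝ) ≤
        |stdMean y n + τ / (2 * √(n : ℝ)) * (stdMean y n ^ 2 - d * sampleVar y n)| := by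
  have hn0 : (0 : ℝ) < n := by positivity
  have hr2 : √(n : ℝ) ^ 2 = n := Real.sq_sqrt hn0.le
  have hr0 : 0 < √(n : ℝ) := by positivity
  have hξ2 : 0 < ξ ^ 2 := by positivity
  have e : sqMeanEstimator d (fun i => ξ + τ * ξ * y i) n - ξ ^ 2 = 2 * τ * ξ ^ 2 / √(n : ℝ) *
      (stdMean y n + τ / (2 * √(n : ℝ)) * (stdMean y n ^ 2 - d * sampleVar y n)) := by
    rw [sqMeanEstimator, sampleMean_affine _ _ _ hn, sampleVar_affine _ _ _ hn]
    unfold stdMean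
    generalize √(n : ℝ) = r at *
    rw [← hr2]
    field_simp
    ring
  have hk : 0 < 2 * τ * ξ ^ 2 / √(n : ℝ) := by positivity
  rw [e, abs_mul, abs_of_pos hk, ← div_le_iff₀' hk]
  have : ε / (2 * τ * ξ ^ 2) * √(n : ℝ) = ε / (2 * τ * ξ ^ 2 / √(n : ℝ)) := by field_simp
  rw [this]

lemma summable_one_div_mul_sqrt : Summable fun n : ℕ => 1 / ((n : ℝ) * √(n : ℝ)) := by
  have h := Real.summable_one_div_nat_rpow (p := 3 / 2) |>.2 (by norm_num)
  refine h.congr fun n => ?_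
  rcases Nat.eq_zero_or_pos n with rfl | hn
  · simp
  · have : (0 : ℝ) < n := by positivity
    rw [show (3 / 2 : ℝ) = 1 + 1 / 2 by norm_num, Real.rpow_add this, Real.rpow_one,
      Real.sqrt_eq_rpow]

namespace IsStdNormalSample

variable {Ω : Type*} [MeasurableSpace Ω] {P : Measure Ω} {Y : ℕ → Ω → ℝ}

lemma nullMeasurableSet_dev (h : IsStdNormalSample Y P) (d b u : ℝ) (n : ℕ) :
    NullMeasurableSet {ω | u ≤ |stdMean (fun i => Y i ω) n
      + b * (stdMean (fun i => Y i ω) n ^ 2 - d * sampleVar (fun i => Y i ω) n)|} P := by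
  have := h.aemeasurable_stdMean n
  have := h.aemeasurable_sampleVar n
  refine nullMeasurableSet_le aemeasurable_const ?_
  exact measurable_abs.comp_aemeasurable (by fun_prop)

variable [IsProbabilityMeasure P]

lemma summable_devProb (h : IsStdNormalSample Y P) (d : ℝ) {τ κ : ℝ} (hτ : 0 < τ) (hκ : 0 < κ)
    {N : ℕ} (hN : 2 ≤ N) : Summable fun k : ℕ =>
      devProb P Y d (τ / (2 * √((k + N : ℕ) : ℝ))) (κ * √((k + N : ℕ) : ℝ)) (k + N) := by
  obtain ⟨C, hC⟩ := h.exists_devProb_le d hτ hκ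
  have hs : Summable fun k : ℕ => C * (1 / ((k + N : ℕ) : ℝ) ^ 2) :=
    ((summable_nat_add_iff N).2 (Real.summable_one_div_nat_pow.2 one_lt_two)).mul_left C
  exact Summable.of_nonneg_of_le (fun k => measureReal_nonneg) (fun k => hC _ (by omega)) hs

/-- The sum over the sample sizes of the change in the deviation probabilities. -/
lemma exists_abs_tsum_devProb_sub_le (h : IsStdNormalSample Y P) (d : ℝ) {τ : ℝ} (hτ : 0 < τ) :
    ∃ C, ∀ (N : ℕ) (κ : ℝ), 2 ≤ N → 0 < κ →
      |∑' k : ℕ, devProb P Y d (τ / (2 * √((k + N : ℕ) : ℝ))) (κ * √((k + N : ℕ) : ℝ)) (k + N)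
        - ∑' k : ℕ, devProb P Y 0 (τ / (2 * √((k + N : ℕ) : ℝ))) (κ * √((k + N : ℕ) : ℝ)) (k + N)
        - τ ^ 2 / 2 * ((d ^ 2 + 2 * d) / 2 - gainPrim d (κ * √(N : ℝ)))|
        ≤ C * ∑' k : ℕ, 1 / (((k + N : ℕ) : ℝ) * √((k + N : ℕ) : ℝ)) := by
  obtain ⟨C, hC, hT⟩ := h.exists_abs_devProb_sub_gainPrim_le d hτ
  refine ⟨C, fun N κ hN hκ => ?_⟩
  have s1 := h.summable_devProb d hτ hκ hN
  have s0 := h.summable_devProb 0 hτ hκ hN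
  have sR : Summable fun k : ℕ => 1 / (((k + N : ℕ) : ℝ) * √((k + N : ℕ) : ℝ)) :=
    (summable_nat_add_iff N).2 summable_one_div_mul_sqrt
  set p : ℕ → ℝ := fun k =>
    devProb P Y d (τ / (2 * √((k + N : ℕ) : ℝ))) (κ * √((k + N : ℕ) : ℝ)) (k + N)
  set q : ℕ → ℝ := fun k =>
    devProb P Y 0 (τ / (2 * √((k + N : ℕ) : ℝ))) (κ * √((k + N : ℕ) : ℝ)) (k + N)
  set g : ℕ → ℝ := fun k => gainPrim d (κ * √((k + N : ℕ) : ℝ))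
  have hE : ∀ k, ‖p k - q k - τ ^ 2 / 2 * (g (k + 1) - g k)‖
      ≤ C * (1 / (((k + N : ℕ) : ℝ) * √((k + N : ℕ) : ℝ))) := fun k => by
    have := hT (k + N) κ (by omega) hκ
    rw [Real.norm_eq_abs]
    have e : g (k + 1) = gainPrim d (κ * √(((k + N : ℕ) : ℝ) + 1)) := by
      simp only [g]; congr 3; push_cast; ring
    rw [e]
    exact this
  have sE : Summable fun k => p k - q k - τ ^ 2 / 2 * (g (k + 1) - g k) :=
    Summable.of_norm_bounded (sR.mul_left C) hE
  -- The increments are summable as a difference of summable series, without any monotonicity of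
  -- `gainPrim`.
  have sG : Summable fun k => τ ^ 2 / 2 * (g (k + 1) - g k) := by
    refine ((s1.sub s0).sub sE).congr fun k => ?_
    simp only [p, q]; ring
  have hg : Tendsto g atTop (𝓝 ((d ^ 2 + 2 * d) / 2)) := by
    refine (tendsto_gainPrim d).comp (Tendsto.const_mul_atTop hκ ?_)
    refine Real.tendsto_sqrt_atTop.comp (tendsto_natCast_atTop_atTop.comp ?_)
    exact tendsto_add_atTop_nat N
  have tG : ∑' k, τ ^ 2 / 2 * (g (k + 1) - g k)
      = τ ^ 2 / 2 * ((d ^ 2 + 2 * d) / 2 - gainPrim d (κ * √(N : ℝ))) := by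
    refine tendsto_nhds_unique sG.hasSum.tendsto_sum_nat ?_
    simp_rw [← Finset.mul_sum, Finset.sum_range_sub]
    have : g 0 = gainPrim d (κ * √(N : ℝ)) := by simp [g]
    rw [this]
    exact (hg.sub_const _).const_mul _
  have tE : ∑' k, (p k - q k - τ ^ 2 / 2 * (g (k + 1) - g k))
      = ∑' k, p k - ∑' k, q k
        - τ ^ 2 / 2 * ((d ^ 2 + 2 * d) / 2 - gainPrim d (κ * √(N : ℝ))) := by
    rw [(s1.sub s0).tsum_sub sG, s1.tsum_sub s0, tG]
  rw [← tE, ← tsum_mul_left]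
  exact tsum_of_norm_bounded (sR.mul_left C).hasSum hE

end IsStdNormalSample

/-! ### The limit as `ε → 0`. -/

/-- The smallest sample size that is counted. -/
noncomputable def startSize (N : ℝ) : ℕ := max 2 ⌈N⌉₊

lemma two_le_startSize (N : ℝ) : 2 ≤ startSize N := le_max_left _ _

lemma missSet_eq_image (y : ℕ → ℝ) {ξ τ : ℝ} (hξ : ξ ≠ 0) (hτ : 0 < τ) (d ε N : ℝ) :
    missSet d (ξ ^ 2) ε N (fun i => ξ + τ * ξ * y i) = (fun k => k + startSize N) ''
      {k : ℕ | ε / (2 * τ * ξ ^ 2) * √((k + startSize N : ℕ) : ℝ) ≤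
        |stdMean y (k + startSize N) + τ / (2 * √((k + startSize N : ℕ) : ℝ)) *
          (stdMean y (k + startSize N) ^ 2 - d * sampleVar y (k + startSize N))|} := by
  ext n
  simp only [missSet, Set.mem_ofPred_eq, Set.mem_image]
  constructor
  · rintro ⟨h2, hN, hε⟩
    have hle : startSize N ≤ n := max_le h2 (Nat.ceil_le.2 hN)
    refine ⟨n - startSize N, ?_, Nat.sub_add_cancel hle⟩
    rw [Nat.sub_add_cancel hle]
    exact (le_abs_sqMeanEstimator_sub_iff y hξ hτ d ε (by omega)).1 hε
  · rintro ⟨k, hk, rfl⟩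
    have h2 := two_le_startSize N
    refine ⟨by omega, ?_, (le_abs_sqMeanEstimator_sub_iff y hξ hτ d ε (by omega)).2 hk⟩
    exact Nat.ceil_le.1 ((le_max_right 2 _).trans (Nat.le_add_left _ _))

/-- This is the form in which `a(ε) → 0` is used: it says that `κ√N → 0` at the starting size `N`.
-/
lemma tendsto_sq_mul_startSize {a : ℝ → ℝ} (ha : Tendsto a (𝓝[>] 0) (𝓝 0))
    (ha' : Tendsto (fun ε => a ε / ε ^ 2) (𝓝[>] 0) atTop) :
    Tendsto (fun ε : ℝ => ε ^ 2 * startSize (a ε / ε ^ 2)) (𝓝[>] 0) (𝓝 0) := by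
  have hε : Tendsto (fun ε : ℝ => ε) (𝓝[>] 0) (𝓝 0) := nhdsWithin_le_nhds
  have hup : Tendsto (fun ε : ℝ => a ε + 3 * ε ^ 2) (𝓝[>] 0) (𝓝 0) := by
    simpa using ha.add ((hε.pow 2).const_mul 3)
  refine squeeze_zero' (Eventually.of_forall fun ε => by positivity) ?_ hup
  filter_upwards [ha'.eventually_ge_atTop 0, self_mem_nhdsWithin] with ε h0 (hpos : 0 < ε)
  have h1 : (startSize (a ε / ε ^ 2) : ℝ) ≤ a ε / ε ^ 2 + 3 := by
    rw [startSize, Nat.cast_max]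
    apply max_le
    · push_cast; linarith
    · linarith [Nat.ceil_lt_add_one h0]
  calc ε ^ 2 * startSize (a ε / ε ^ 2) ≤ ε ^ 2 * (a ε / ε ^ 2 + 3) := by gcongr
    _ = _ := by field_simp

lemma tendsto_startSize : Tendsto startSize atTop atTop :=
  tendsto_atTop_mono (fun _ => le_max_right _ _) tendsto_nat_ceil_atTop

namespace IsStdNormalSample

variable {Ω : Type*} [MeasurableSpace Ω] {P : Measure Ω} {Y : ℕ → Ω → ℝ}
  [IsProbabilityMeasure P]

lemma missCount_expectation (h : IsStdNormalSample Y P) {ξ τ : ℝ} (hξ : ξ ≠ 0) (hτ : 0 < τ)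
    (d N : ℝ) {ε : ℝ} (hε : 0 < ε) :
    (∀ᵐ ω ∂P, (missSet d (ξ ^ 2) ε N (fun i => ξ + τ * ξ * Y i ω)).Finite) ∧
    Integrable (fun ω => missCount d (ξ ^ 2) ε N (fun i => ξ + τ * ξ * Y i ω)) P ∧
    ∫ ω, missCount d (ξ ^ 2) ε N (fun i => ξ + τ * ξ * Y i ω) ∂P
      = ∑' k : ℕ, devProb P Y d (τ / (2 * √((k + startSize N : ℕ) : ℝ)))
        (ε / (2 * τ * ξ ^ 2) * √((k + startSize N : ℕ) : ℝ)) (k + startSize N) := by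
  have hκ : 0 < ε / (2 * τ * ξ ^ 2) := by positivity
  obtain ⟨h1, h2, h3⟩ := ncard_events_of_summable
    (fun k => h.nullMeasurableSet_dev d (τ / (2 * √((k + startSize N : ℕ) : ℝ)))
      (ε / (2 * τ * ξ ^ 2) * √((k + startSize N : ℕ) : ℝ)) (k + startSize N))
    (h.summable_devProb d hτ hκ (two_le_startSize N))
  have hset := fun ω => missSet_eq_image (fun i => Y i ω) hξ hτ d ε N
  have hcount : ∀ ω, missCount d (ξ ^ 2) ε N (fun i => ξ + τ * ξ * Y i ω) = _ := fun ω => by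
    rw [missCount, hset ω, Set.ncard_image_of_injective _ (add_left_injective _)]
  refine ⟨?_, ?_, ?_⟩
  · filter_upwards [h1] with ω hω
    rw [hset ω]
    exact hω.image _
  · simp_rw [hcount]
    exact h2
  · simp_rw [hcount]
    exact h3

lemma tendsto_integral_missCount_sub (h : IsStdNormalSample Y P) {ξ τ : ℝ} (hξ : ξ ≠ 0)
    (hτ : 0 < τ) {a : ℝ → ℝ} (ha : Tendsto a (𝓝[>] 0) (𝓝 0))
    (ha' : Tendsto (fun ε => a ε / ε ^ 2) (𝓝[>] 0) atTop) (d : ℝ) :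
    Tendsto (fun ε => ∫ ω, missCount d (ξ ^ 2) ε (a ε / ε ^ 2) (fun i => ξ + τ * ξ * Y i ω) ∂P
        - ∫ ω, missCount 0 (ξ ^ 2) ε (a ε / ε ^ 2) (fun i => ξ + τ * ξ * Y i ω) ∂P)
      (𝓝[>] 0) (𝓝 ((1 / 4 * d ^ 2 + 1 / 2 * d) * τ ^ 2)) := by
  obtain ⟨C, hC⟩ := h.exists_abs_tsum_devProb_sub_le d hτ
  -- The starting size tends to infinity because `a(ε)/ε²` does, so the tail of `∑ n^(-3/2)`
  -- vanishes.
  have hR : Tendsto (fun ε => C * ∑' k : ℕ, 1 / (((k + startSize (a ε / ε ^ 2) : ℕ) : ℝ)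
      * √((k + startSize (a ε / ε ^ 2) : ℕ) : ℝ))) (𝓝[>] 0) (𝓝 0) := by
    have := ((tendsto_sum_nat_add fun n : ℕ => 1 / ((n : ℝ) * √(n : ℝ))).comp
      (tendsto_startSize.comp ha')).const_mul C
    simpa using this
  have hu : Tendsto (fun ε : ℝ => ε / (2 * τ * ξ ^ 2) * √(startSize (a ε / ε ^ 2) : ℝ))
      (𝓝[>] 0) (𝓝 0) := by
    have h1 := ((tendsto_sq_mul_startSize ha ha').sqrt).const_mul (2 * τ * ξ ^ 2)⁻¹
    rw [Real.sqrt_zero, mul_zero] at h1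
    refine h1.congr' ?_
    filter_upwards [self_mem_nhdsWithin] with ε (hε : 0 < ε)
    rw [Real.sqrt_mul (by positivity), Real.sqrt_sq hε.le]
    ring
  -- The lower boundary term of the telescoped sum tends to `M(0) = 0`.
  have hM : Tendsto (fun ε : ℝ => τ ^ 2 / 2 * ((d ^ 2 + 2 * d) / 2
      - gainPrim d (ε / (2 * τ * ξ ^ 2) * √(startSize (a ε / ε ^ 2) : ℝ))))
      (𝓝[>] 0) (𝓝 ((1 / 4 * d ^ 2 + 1 / 2 * d) * τ ^ 2)) := by
    have h1 := ((((continuous_gainPrim d).tendsto 0).comp hu).const_sub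
      ((d ^ 2 + 2 * d) / 2)).const_mul (τ ^ 2 / 2)
    rw [gainPrim_zero] at h1
    convert! h1 using 2
    ring
  have hdiff : Tendsto (fun ε =>
      (∫ ω, missCount d (ξ ^ 2) ε (a ε / ε ^ 2) (fun i => ξ + τ * ξ * Y i ω) ∂P
        - ∫ ω, missCount 0 (ξ ^ 2) ε (a ε / ε ^ 2) (fun i => ξ + τ * ξ * Y i ω) ∂P)
      - τ ^ 2 / 2 * ((d ^ 2 + 2 * d) / 2
      - gainPrim d (ε / (2 * τ * ξ ^ 2) * √(startSize (a ε / ε ^ 2) : ℝ))))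
      (𝓝[>] 0) (𝓝 0) := by
    refine squeeze_zero_norm' ?_ hR
    filter_upwards [self_mem_nhdsWithin] with ε (hε : 0 < ε)
    rw [(h.missCount_expectation hξ hτ d _ hε).2.2, (h.missCount_expectation hξ hτ 0 _ hε).2.2]
    exact hC _ _ (two_le_startSize _) (by positivity)
  simpa using hdiff.add hM

end IsStdNormalSample

/-! ### Reduction to standard normal observations and conclusion. -/

/-- Standardizing independent normal observations. -/
lemma isStdNormalSample_standardize {Ω : Type*} [MeasurableSpace Ω] {P : Measure Ω}
    {ξ c : ℝ} {σ : ℝ≥0} (hσ : 0 < σ) (hc : c ^ 2 = (σ : ℝ) ^ 2) {X : ℕ → Ω → ℝ}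
    (hindep : iIndepFun X P) (hlaw : ∀ i, HasLaw (X i) (gaussianReal ξ (σ ^ 2)) P) :
    IsStdNormalSample (fun i ω => (X i ω - ξ) / c) P where
  indep := hindep.comp (fun _ x => (x - ξ) / c) fun _ => by fun_prop
  law i := by
    have h1 := gaussianReal_div_const (gaussianReal_sub_const (hlaw i) ξ) c
    have h2 : σ ^ 2 / NNReal.mk (c ^ 2) (sq_nonneg c) = 1 := by
      ext
      push_cast
      rw [hc]
      exact div_self (by positivity)
    rwa [sub_self, zero_div, h2] at h1

theorem mainTheorem5 {Ω : Type*} [MeasurableSpace Ω] (P : Measure Ω) [IsProbabilityMeasure P]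
    (ξ : ℝ) (hξ : ξ ≠ 0) (σ : ℝ≥0) (hσ : 0 < σ)
    (X : ℕ → Ω → ℝ) (hindep : iIndepFun X P)
    (hlaw : ∀ i, HasLaw (X i) (gaussianReal ξ (σ ^ 2)) P)
    (a : ℝ → ℝ) (ha : Tendsto a (𝓝[>] 0) (𝓝 0))
    (ha' : Tendsto (fun ε => a ε / ε ^ 2) (𝓝[>] 0) atTop) :
    -- the miss counts are almost surely finite, with finite expectation
    (∀ d ε : ℝ, 0 < ε →
      (∀ᵐ ω ∂P, (missSet d (ξ ^ 2) ε (a ε / ε ^ 2) (fun i => X i ω)).Finite) ∧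
      Integrable (fun ω => missCount d (ξ ^ 2) ε (a ε / ε ^ 2) (fun i => X i ω)) P) ∧
    -- the limiting expected difference
    (∀ d : ℝ, Tendsto
      (fun ε => ∫ ω, (missCount d (ξ ^ 2) ε (a ε / ε ^ 2) (fun i => X i ω)
        - missCount 0 (ξ ^ 2) ε (a ε / ε ^ 2) (fun i => X i ω)) ∂P)
      (𝓝[>] 0) (𝓝 ((1 / 4 * d ^ 2 + 1 / 2 * d) * (σ : ℝ) ^ 2 / ξ ^ 2))) ∧
    -- the choice `d = -1` is strictly better than every other choice
    (∀ d : ℝ, d ≠ -1 →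
      (1 / 4 * (-1 : ℝ) ^ 2 + 1 / 2 * (-1 : ℝ)) * (σ : ℝ) ^ 2 / ξ ^ 2
        < (1 / 4 * d ^ 2 + 1 / 2 * d) * (σ : ℝ) ^ 2 / ξ ^ 2 ∧
      Tendsto
        (fun ε => ∫ ω, (missCount d (ξ ^ 2) ε (a ε / ε ^ 2) (fun i => X i ω)
          - missCount (-1) (ξ ^ 2) ε (a ε / ε ^ 2) (fun i => X i ω)) ∂P)
        (𝓝[>] 0) (𝓝 (1 / 4 * (d + 1) ^ 2 * (σ : ℝ) ^ 2 / ξ ^ 2)) ∧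
      ∀ᶠ ε in 𝓝[>] (0 : ℝ),
        ∫ ω, missCount (-1) (ξ ^ 2) ε (a ε / ε ^ 2) (fun i => X i ω) ∂P
          < ∫ ω, missCount d (ξ ^ 2) ε (a ε / ε ^ 2) (fun i => X i ω) ∂P) := by
  have hσ' : (0 : ℝ) < σ := hσ
  have hξa : 0 < |ξ| := abs_pos.2 hξ
  obtain ⟨τ, hτdef⟩ : ∃ τ, τ = (σ : ℝ) / |ξ| := ⟨_, rfl⟩
  have hτ : 0 < τ := by rw [hτdef]; positivity
  have hτ2 : τ ^ 2 = (σ : ℝ) ^ 2 / ξ ^ 2 := by rw [hτdef, div_pow, sq_abs]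
  have hc : (τ * ξ) ^ 2 = (σ : ℝ) ^ 2 := by rw [mul_pow, hτ2]; field_simp
  have hc0 : τ * ξ ≠ 0 := mul_ne_zero hτ.ne' hξ
  have hY := isStdNormalSample_standardize (ξ := ξ) hσ hc hindep hlaw
  have hX : ∀ ω, (fun i => X i ω) = fun i => ξ + τ * ξ * ((X i ω - ξ) / (τ * ξ)) := fun ω => by
    funext i
    rw [mul_div_cancel₀ _ hc0]
    ring
  have hexp := fun (d ε : ℝ) (hε : 0 < ε) => hY.missCount_expectation hξ hτ d (a ε / ε ^ 2) hε
  have hlim := hY.tendsto_integral_missCount_sub hξ hτ ha ha'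
  simp_rw [← hX] at hexp hlim
  -- Comparison through `d = 0`: integrability turns the difference of expectations into the
  -- expectation of the difference.
  have hpair : ∀ d d' : ℝ, Tendsto
      (fun ε => ∫ ω, (missCount d (ξ ^ 2) ε (a ε / ε ^ 2) (fun i => X i ω)
        - missCount d' (ξ ^ 2) ε (a ε / ε ^ 2) (fun i => X i ω)) ∂P) (𝓝[>] 0)
      (𝓝 ((1 / 4 * d ^ 2 + 1 / 2 * d) * τ ^ 2 - (1 / 4 * d' ^ 2 + 1 / 2 * d') * τ ^ 2)) := by
    intro d d'
    refine ((hlim d).sub (hlim d')).congr' ?_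
    filter_upwards [self_mem_nhdsWithin] with ε (hε : 0 < ε)
    rw [integral_sub (hexp d ε hε).2.1 (hexp d' ε hε).2.1]
    ring
  have hgap : ∀ d : ℝ, Tendsto
      (fun ε => ∫ ω, (missCount d (ξ ^ 2) ε (a ε / ε ^ 2) (fun i => X i ω)
        - missCount (-1) (ξ ^ 2) ε (a ε / ε ^ 2) (fun i => X i ω)) ∂P)
      (𝓝[>] 0) (𝓝 (1 / 4 * (d + 1) ^ 2 * (σ : ℝ) ^ 2 / ξ ^ 2)) := fun d => by
    convert! hpair d (-1) using 2
    rw [hτ2]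
    ring
  refine ⟨fun d ε hε => ⟨(hexp d ε hε).1, (hexp d ε hε).2.1⟩, fun d => ?_, fun d hd => ?_⟩
  · convert! hpair d 0 using 2
    rw [hτ2]
    ring
  · have hpos : 0 < 1 / 4 * (d + 1) ^ 2 * (σ : ℝ) ^ 2 / ξ ^ 2 := by
      have : d + 1 ≠ 0 := fun h => hd (by linarith)
      positivity
    refine ⟨?_, hgap d, ?_⟩
    · rw [← sub_pos]
      convert! hpos using 1
      ring
    · filter_upwards [(hgap d).eventually (lt_mem_nhds hpos), self_mem_nhdsWithin] with ε h1
        (hε : 0 < ε)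
      rw [integral_sub (hexp d ε hε).2.1 (hexp (-1) ε hε).2.1] at h1
      linarith
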